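/- Let $\mathcal V=[\mathbb C^{\mathrm{op}},\mathbf{Set}]$ be a presheaf category ($\mathbb C$ small), let $T$ be a monad on $\mathcal V$ whose functor part preserves small coproducts, and let $P$ be a (classical, non-symmetric) operad in the category of algebras $\mathcal V^T$, with respect to cartesian product. Let $U:\mathcal V^T\to\mathcal V$ be the forgetful functor and let $UP$ be the operad in $\mathcal V$ with $(UP)(k)=U(P(k))$. A $\mathcal V$-graph $A$ is a set $A_0$ with objects $A(a,a')\in\mathcal V$ for $a,a'\in A_0$; a morphism is a function on objects together with morphisms $A(a,a')\to B(Fa,Fa')$; these form a category $\mathcal V\text{-}\mathbf{Gph}$. For an operad $Q$ in a category $\mathcal W$ with finite products, a $(\mathcal W,Q)$-category is a $\mathcal W$-graph $A$ with morphisms $Q(k)\times A(a_{k-1},a_k)\times\cdots\times A(a_0,a_1)\to A(a_0,a_k)$ for all $k\ge 0$ and $a_0,\dots,a_k\in A_0$, compatible with the unit and composition of $Q$; a morphism is a graph morphism commuting with these composition morphisms. Let $T_*$ be the monad on $\mathcal V\text{-}\mathbf{Gph}$ that is the identity on objects and $T$ on hom-objects, and let $\mathbf{fc}_{(\mathcal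 V,UP)}$ be the monad on $\mathcal V\text{-}\mathbf{Gph}$ that is the identity on objects and has $$(\mathbf{fc}_{(\mathcal V,UP)}A)(a,a')=\coprod_{k\ge 0,\ a=a_0,\dots,a_k=a'} U(P(k))\times A(a_{k-1},a_k)\times\cdots\times A(a_0,a_1),$$ with unit and multiplication induced by the unit and composition of $UP$. Then there is a distributive law of monads $$\lambda: T_*\circ\mathbf{fc}_{(\mathcal V,UP)}\Rightarrow\mathbf{fc}_{(\mathcal V,UP)}\circ T_*$$ whose resulting composite monad $\mathbf{fc}_{(\mathcal V,UP)}\circ T_*$ is the free $(\mathcal V^T,P)$-category monad; that is, there is an isomorphism of categories $$(\mathcal V\text{-}\mathbf{Gph})^{\mathbf{fc}_{(\mathcal V,UP)}\circ T_*}\;\cong\;(\mathcal V^T,P)\text{-}\mathbf{Cat}$$ commuting with the forgetful functors to $\mathcal V\text{-}\mathbf{Gph}$. -/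

import Mathlib

open CategoryTheory CategoryTheory.Limits Opposite

universe w v v' u u'

/-! ## Distributive laws between monads -/

/-- A distributive law `S ∘ T ⇒ T ∘ S` between monads `S` and `T` on the same category
(functors are composed in diagrammatic order by `⋙`). -/
structure DistributiveLaw {E : Type u} [Category.{v} E] (S T : Monad E) where
  law : T.toFunctor ⋙ S.toFunctor ⟶ S.toFunctor ⋙ T.toFunctor
  unit_left : ∀ X : E, S.η.app (T.obj X) ≫ law.app X = T.map (S.η.app X)
  unit_right : ∀ X : E, S.map (T.η.app X) ≫ law.app X = T.η.app (S.obj X)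
  mul_left : ∀ X : E, S.μ.app (T.obj X) ≫ law.app X =
    S.map (law.app X) ≫ law.app (S.obj X) ≫ T.map (S.μ.app X)
  mul_right : ∀ X : E, S.map (T.μ.app X) ≫ law.app X =
    law.app (T.obj X) ≫ T.map (law.app X) ≫ T.μ.app (S.obj X)

namespace DistributiveLaw

variable {E : Type u} [Category.{v} E] {S T : Monad E}

theorem law_naturality (d : DistributiveLaw S T) {X Y : E} (f : X ⟶ Y) :
    S.map (T.map f) ≫ d.law.app Y = d.law.app X ≫ T.map (S.map f) :=
  d.law.naturality f

/-- The composite monad `T ∘ S` induced by a distributive law `S ∘ T ⇒ T ∘ S`. -/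
def composite (d : DistributiveLaw S T) : Monad E where
  toFunctor := S.toFunctor ⋙ T.toFunctor
  η :=
    { app := fun X => S.η.app X ≫ T.η.app (S.obj X)
      naturality := by
        intro X Y f
        have h := S.η.naturality f
        have h' := T.η.naturality (S.map f)
        dsimp at h h' ⊢
        rw [reassoc_of% h, h', Category.assoc] }
  μ :=
    { app := fun X => T.map (d.law.app (S.obj X)) ≫ T.μ.app (S.obj (S.obj X)) ≫
        T.map (S.μ.app X)
      naturality := by
        intro X Y f
        have h := d.law_naturality (S.map f)
        have h1 := T.μ.naturality (S.map (S.map f))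
        have h2 := S.μ.naturality f
        dsimp at h h1 h2 ⊢
        simp only [Category.assoc]
        rw [← T.map_comp_assoc, h, T.map_comp_assoc, reassoc_of% h1, ← T.map_comp, h2,
          T.map_comp] }
  assoc := by
    intro X
    have e1 := d.mul_left (S.obj X)
    have e2 := d.mul_right (S.obj (S.obj X))
    have n1 := d.law_naturality (S.μ.app X)
    have n2 := d.law_naturality (d.law.app (S.obj X))
    have m1 := T.μ.naturality (S.map (d.law.app (S.obj X)))
    have m2 := T.μ.naturality (d.law.app (S.obj (S.obj X)))
    have m3 := T.μ.naturality (S.map (S.μ.app X))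
    have m4 := T.μ.naturality (S.μ.app (S.obj X))
    have a1 := T.assoc (S.obj (S.obj (S.obj X)))
    have a2 := S.assoc X
    dsimp at e1 e2 n1 n2 m1 m2 m3 m4 a1 a2 ⊢
    simp only [Functor.map_comp, Category.assoc]
    calc
      _ = T.map (S.map (T.map (d.law.app (S.obj X))) ≫
            (S.map (T.μ.app (S.obj (S.obj X))) ≫
            (S.map (T.map (S.μ.app X)) ≫ d.law.app (S.obj X)))) ≫
            T.μ.app _ ≫ T.map (S.μ.app X) := by
          simp only [Functor.map_comp, Category.assoc]
      _ = T.map (d.law.app (S.obj (T.obj (S.obj X)))) ≫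
            T.map (T.map (S.map (d.law.app (S.obj X)))) ≫
            T.map (T.map (d.law.app (S.obj (S.obj X)))) ≫
            T.map (T.μ.app _) ≫ (T.map (T.map (S.map (S.μ.app X))) ≫
            T.μ.app _) ≫ T.map (S.μ.app X) := by
          rw [n1, reassoc_of% e2, reassoc_of% n2]
          simp only [Functor.map_comp, Category.assoc]
      _ = T.map (d.law.app (S.obj (T.obj (S.obj X)))) ≫
            T.map (T.map (S.map (d.law.app (S.obj X)))) ≫
            T.map (T.map (d.law.app (S.obj (S.obj X)))) ≫
            T.μ.app (T.obj (S.obj (S.obj (S.obj X)))) ≫ T.μ.app _ ≫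
            T.map (S.μ.app _) ≫ T.map (S.μ.app X) := by
          rw [m3]
          simp only [Category.assoc]
          rw [← T.map_comp, a2, reassoc_of% a1, T.map_comp]
      _ = _ := by
          rw [reassoc_of% m2, reassoc_of% m1, ← reassoc_of% m4,
            ← T.map_comp_assoc (S.μ.app _), e1]
          simp only [Functor.map_comp, Category.assoc]
  left_unit := by
    intro X
    have e1 := d.unit_left (S.obj X)
    have m1 := T.η.naturality (d.law.app (S.obj X))
    have a1 := T.left_unit (S.obj (S.obj X))
    have a2 := S.left_unit X
    dsimp at e1 m1 a1 a2 ⊢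
    rw [Category.assoc, ← reassoc_of% m1, reassoc_of% a1, reassoc_of% e1, ← T.map_comp, a2,
      T.map_id]
  right_unit := by
    intro X
    have e1 := d.unit_right (S.obj X)
    have a1 := T.right_unit (S.obj (S.obj X))
    have n1 := d.law_naturality (S.η.app X)
    have m1 := T.η.naturality (S.map (S.η.app X))
    have a2 := S.right_unit X
    dsimp at e1 m1 a1 a2 ⊢
    rw [← T.map_comp_assoc, S.map_comp, Category.assoc, e1, T.map_comp, Category.assoc,
      reassoc_of% a1, ← T.map_comp, a2, T.map_id]

end DistributiveLaw

/-! ## Graphs enriched in a category -/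

/-- A `V`-graph: a set of objects and, for each pair of objects, a hom-object in `V`. -/
structure VGraph (V : Type u) [Category.{v} V] where
  obj : Type w
  hom : obj → obj → V

namespace VGraph

/-- A morphism of `V`-graphs. -/
@[ext]
structure Hom {V : Type u} [Category.{v} V] (A B : VGraph.{w} V) where
  obj : A.obj → B.obj
  hom : ∀ a b : A.obj, A.hom a b ⟶ B.hom (obj a) (obj b)

instance (V : Type u) [Category.{v} V] : Category (VGraph.{w} V) where
  Hom A B := Hom A B
  id A := ⟨fun a => a, fun a b => 𝟙 (A.hom a b)⟩
  comp F G := ⟨fun a => G.obj (F.obj a), fun a b => F.hom a b ≫ G.hom (F.obj a) (F.obj b)⟩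

variable {V : Type u} [Category.{v} V] {W : Type u'} [Category.{v'} W]

/-- The functor `F_* : V-Gph ⥤ W-Gph`, the identity on objects and `F` on hom-objects. -/
def mapFunctor (F : V ⥤ W) : VGraph.{w} V ⥤ VGraph.{w} W where
  obj A := ⟨A.obj, fun a b => F.obj (A.hom a b)⟩
  map f := ⟨f.obj, fun a b => F.map (f.hom a b)⟩
  map_id A := by
    refine Hom.ext rfl (heq_of_eq ?_)
    funext a b
    exact F.map_id _
  map_comp f g := by
    refine Hom.ext rfl (heq_of_eq ?_)
    funext a b
    exact F.map_comp _ _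

/-- The monad `T_*` on `V-Gph` induced by a monad `T` on `V`. -/
def mapMonad (T : Monad V) : Monad (VGraph.{w} V) where
  toFunctor := mapFunctor T.toFunctor
  η :=
    { app := fun A => ⟨fun a => a, fun a b => T.η.app (A.hom a b)⟩
      naturality := by
        intro A B f
        refine Hom.ext rfl (heq_of_eq ?_)
        funext a b
        exact T.η.naturality (f.hom a b) }
  μ :=
    { app := fun A => ⟨fun a => a, fun a b => T.μ.app (A.hom a b)⟩
      naturality := by
        intro A B f
        refine Hom.ext rfl (heq_of_eq ?_)
        funext a b
        exact T.μ.naturality (f.hom a b) }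
  assoc A := by
    refine Hom.ext rfl (heq_of_eq ?_)
    funext a b
    exact T.assoc (A.hom a b)
  left_unit A := by
    refine Hom.ext rfl (heq_of_eq ?_)
    funext a b
    exact T.left_unit (A.hom a b)
  right_unit A := by
    refine Hom.ext rfl (heq_of_eq ?_)
    funext a b
    exact T.right_unit (A.hom a b)

end VGraph

/-! ## Strings of composable arrows -/

/-- `Str H a b` is the type of strings `(f_k, ..., f_1)` of composable arrows
`f_i : H a_{i-1} a_i` with `a_0 = a` and `a_k = b`, where `k ≥ 0`.  As in the product
`A(a_{k-1}, a_k) × ⋯ × A(a_0, a_1)`, the arrow `f_k` comes first. -/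
inductive Str {O : Type u} (H : O → O → Type v) (a : O) : O → Type (max u v)
  | nil : Str H a a
  | cons {b c : O} (f : H b c) (s : Str H a b) : Str H a c

namespace Str

variable {O : Type u} {H : O → O → Type v}

/-- The number of arrows of a string. -/
def length {a : O} : ∀ {b : O}, Str H a b → ℕ
  | _, nil => 0
  | _, cons _ s => s.length + 1

/-- Apply a map of graphs to every arrow of a string. -/
def map {O' : Type u'} {H' : O' → O' → Type v'} (g : O → O')
    (F : ∀ a b, H a b → H' (g a) (g b)) {a : O} : ∀ {b : O}, Str H a b → Str H' (g a) (g b)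
  | _, nil => nil
  | _, cons f s => cons (F _ _ f) (s.map g F)

/-- `append t s` is the string `t` followed (to the right) by the string `s`. -/
def append {a b : O} : ∀ {c : O}, Str H b c → Str H a b → Str H a c
  | _, nil, s => s
  | _, cons f t, s => cons f (append t s)

/-- Concatenate a string of strings. -/
def flatten {a : O} : ∀ {b : O}, Str (fun a b => Str H a b) a b → Str H a b
  | _, nil => nil
  | _, cons t s => append t s.flatten

/-- The list of values of a function on the arrows of a string, in the same order. -/
def toList {β : Type w} (φ : ∀ {a b : O}, H a b → β) {a : O} : ∀ {b : O}, Str H a b → List β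
  | _, nil => []
  | _, cons f s => φ f :: s.toList φ

section lemmas

variable {O' : Type u'} {H' : O' → O' → Type v'}

@[simp] theorem length_map (g : O → O') (F : ∀ a b, H a b → H' (g a) (g b)) {a b : O}
    (s : Str H a b) : (s.map g F).length = s.length := by
  induction s with
  | nil => rfl
  | cons f s ih => simp [map, length, ih]

@[simp] theorem length_toList {β : Type*} (φ : ∀ {a b : O}, H a b → β) {a b : O}
    (s : Str H a b) : (s.toList φ).length = s.length := by
  induction s with
  | nil => rfl
  | cons f s ih => simp [toList, length, ih]

theorem length_append {a b c : O} (t : Str H b c) (s : Str H a b) :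
    (append t s).length = t.length + s.length := by
  induction t with
  | nil => simp [append, length]
  | cons f t ih => simp [append, length, ih]; omega

theorem length_flatten {a b : O} (s : Str (fun a b => Str H a b) a b) :
    s.flatten.length = (s.toList (fun t => t.length)).sum := by
  induction s with
  | nil => rfl
  | cons f s ih => simp [flatten, toList, length_append, ih]

theorem append_nil {a b : O} (s : Str H a b) : append s nil = s := by
  induction s with
  | nil => rfl
  | cons f s ih => simp [append, ih]

theorem append_assoc {a b c d : O} (r : Str H c d) (t : Str H b c) (s : Str H a b) :
    append (append r t) s = append r (append t s) := by
  induction r with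
  | nil => rfl
  | cons f r ih => simp [append, ih]

theorem map_append (g : O → O') (F : ∀ a b, H a b → H' (g a) (g b)) {a b c : O}
    (t : Str H b c) (s : Str H a b) :
    (append t s).map g F = append (t.map g F) (s.map g F) := by
  induction t with
  | nil => rfl
  | cons f t ih => simp [append, map, ih]

theorem map_flatten (g : O → O') (F : ∀ a b, H a b → H' (g a) (g b)) {a b : O}
    (s : Str (fun a b => Str H a b) a b) :
    s.flatten.map g F =
      (s.map (H' := fun a b => Str H' a b) g (fun _ _ t => t.map g F)).flatten := by
  induction s with
  | nil => rfl
  | cons f s ih => simp [flatten, map, map_append, ih]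

theorem flatten_append {a b c : O} (t : Str (fun a b => Str H a b) b c)
    (s : Str (fun a b => Str H a b) a b) :
    (append t s).flatten = append t.flatten s.flatten := by
  induction t with
  | nil => rfl
  | cons f t ih => simp [append, flatten, append_assoc, ih]

theorem flatten_flatten {a b : O}
    (s : Str (fun a b => Str (fun a b => Str H a b) a b) a b) :
    s.flatten.flatten = (s.map (fun a => a) (fun _ _ t => t.flatten)).flatten := by
  induction s with
  | nil => rfl
  | cons f s ih => simp [flatten, map, flatten_append, ih]

theorem map_id {a b : O} (s : Str H a b) : s.map (fun a => a) (fun _ _ f => f) = s := by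
  induction s with
  | nil => rfl
  | cons f s ih => simp [map, ih]

theorem map_map {O'' : Type*} {H'' : O'' → O'' → Type*} (g : O → O')
    (F : ∀ a b, H a b → H' (g a) (g b)) (g' : O' → O'')
    (F' : ∀ a b, H' a b → H'' (g' a) (g' b)) {a b : O} (s : Str H a b) :
    (s.map g F).map g' F' = s.map (fun a => g' (g a)) (fun a b f => F' _ _ (F a b f)) := by
  induction s with
  | nil => rfl
  | cons f s ih => simp [map, ih]

theorem toList_map {β : Type*} (φ : ∀ {a b : O'}, H' a b → β) (g : O → O')
    (F : ∀ a b, H a b → H' (g a) (g b)) {a b : O} (s : Str H a b) :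
    (s.map g F).toList φ = s.toList (fun f => φ (F _ _ f)) := by
  induction s with
  | nil => rfl
  | cons f s ih => simp [map, toList, ih]

theorem map_toList {β γ : Type*} (φ : ∀ {a b : O}, H a b → β) (ψ : β → γ) {a b : O}
    (s : Str H a b) : (s.toList φ).map ψ = s.toList (fun f => ψ (φ f)) := by
  induction s with
  | nil => rfl
  | cons f s ih => simp [toList, ih]

theorem toList_append {β : Type*} (φ : ∀ {a b : O}, H a b → β) {a b c : O}
    (t : Str H b c) (s : Str H a b) :
    (append t s).toList φ = t.toList φ ++ s.toList φ := by
  induction t with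
  | nil => rfl
  | cons f t ih => simp [append, toList, ih]

theorem toList_flatten {β : Type*} (φ : ∀ {a b : O}, H a b → β) {a b : O}
    (s : Str (fun a b => Str H a b) a b) :
    s.flatten.toList φ = (s.toList (fun t => t.toList φ)).flatten := by
  induction s with
  | nil => rfl
  | cons f s ih => simp [flatten, toList, toList_append, ih]

theorem toList_const {β : Type*} (x : β) {a b : O} (s : Str H a b) :
    s.toList (fun _ => x) = List.replicate s.length x := by
  induction s with
  | nil => rfl
  | cons f s ih => simp [toList, length, ih, List.replicate_succ]

theorem flatten_map_single {a b : O} (s : Str H a b) :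
    (s.map (H' := fun a b => Str H a b) (fun a => a)
      (fun _ _ f => cons f nil)).flatten = s := by
  induction s with
  | nil => rfl
  | cons f s ih => simp [flatten, map, append, ih]

end lemmas

end Str

/-! ## Operads -/

/-- A non-symmetric operad in sets, presented by the set `E` of all its operations together
with their arities. -/
structure SetOperad (E : Type v) where
  arity : E → ℕ
  one : E
  comp : ∀ (p : E) (l : List E), l.length = arity p → E
  arity_one : arity one = 1
  arity_comp : ∀ p l h, arity (comp p l h) = (l.map arity).sum
  one_comp : ∀ q : E, comp one [q] (by simp [arity_one]) = q
  comp_one : ∀ p : E, comp p (List.replicate (arity p) one) (by simp) = p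
  assoc : ∀ (p : E) (L : List {x : E × List E // x.2.length = arity x.1})
    (h : L.length = arity p),
    comp (comp p (L.map (fun x => x.1.1)) (by simp [h])) (L.flatMap (fun x => x.1.2))
      (by
        rw [arity_comp, List.length_flatMap, List.map_map]
        congr 1
        exact List.map_congr_left (fun x _ => x.2)) =
    comp p (L.map (fun x => comp x.1.1 x.1.2 x.2)) (by simp [h])

namespace SetOperad

/-- `O.Free H a b` is the disjoint union, over `k ≥ 0` and `a = a_0, ..., a_k = b`, of the
products `O(k) × H(a_{k-1}, a_k) × ⋯ × H(a_0, a_1)`. -/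
@[ext]
structure Free {E : Type v} (O : SetOperad E) {S : Type u} (H : S → S → Type v') (a b : S) :
    Type (max u v v') where
  op : E
  str : Str H a b
  length_eq : str.length = O.arity op

variable {E : Type v} (O : SetOperad E) {S : Type u} {H : S → S → Type v'}

theorem comp_congr {p p' : E} {l l' : List E} (hp : p = p') (hl : l = l')
    (h : l.length = O.arity p) :
    O.comp p l h = O.comp p' l' (by rw [← hp, ← hl, h]) := by
  subst hp hl
  rfl

namespace Free

/-- A single arrow together with the identity operation. -/
def pure {a b : S} (f : H a b) : O.Free H a b where
  op := O.one
  str := Str.cons f (Str.nil)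
  length_eq := O.arity_one.symm

variable {O}

/-- Compose the operations and concatenate the strings. -/
def join {a b : S} (x : O.Free (fun a b => O.Free H a b) a b) : O.Free H a b where
  op := O.comp x.op (x.str.toList (fun y => y.op)) (by rw [Str.length_toList, x.length_eq])
  str := (x.str.map (fun a => a) (fun _ _ y => y.str)).flatten
  length_eq := by
    rw [Str.length_flatten, Str.toList_map, O.arity_comp, Str.map_toList]
    congr 1
    congr 1
    funext a b y
    exact y.length_eq

/-- The map induced by an arity-preserving map of operations and a map of graphs. -/
def map {E' : Type*} {O' : SetOperad E'} (φ : E → E') (hφ : ∀ p, O'.arity (φ p) = O.arity p)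
    {S' : Type*} {H' : S' → S' → Type*} (g : S → S') (F : ∀ a b, H a b → H' (g a) (g b))
    {a b : S} (x : O.Free H a b) : O'.Free H' (g a) (g b) where
  op := φ x.op
  str := x.str.map g F
  length_eq := by rw [Str.length_map, hφ, x.length_eq]

theorem join_pure {a b : S} (x : O.Free H a b) : join (pure O x) = x := by
  refine Free.ext ?_ ?_
  · exact O.one_comp x.op
  · simp [join, pure, Str.map, Str.flatten, Str.append_nil]

theorem join_map_pure {a b : S} (x : O.Free H a b) :
    join (map (O := O) (O' := O) (fun p => p) (fun _ => rfl) (fun a => a)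
      (fun _ _ f => pure O f) x) = x := by
  refine Free.ext ?_ ?_
  · refine Eq.trans (O.comp_congr rfl ?_ _) (O.comp_one x.op)
    simp only [map, Str.toList_map, pure]
    rw [Str.toList_const, x.length_eq]
  · simp only [join, map, pure, Str.map_map]
    exact Str.flatten_map_single _

theorem join_join {a b : S}
    (x : O.Free (fun a b => O.Free (fun a b => O.Free H a b) a b) a b) :
    join (join x) = join (map (O := O) (O' := O) (fun p => p) (fun _ => rfl) (fun a => a)
      (fun _ _ y => join y) x) := by
  refine Free.ext ?_ ?_
  · have h := O.assoc x.op (x.str.toList (fun y =>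
      ⟨(y.op, y.str.toList (fun z => z.op)), by rw [Str.length_toList, y.length_eq]⟩))
      (by rw [Str.length_toList, x.length_eq])
    refine Eq.trans (O.comp_congr ?_ ?_ _) (h.trans (O.comp_congr rfl ?_ _))
    · exact O.comp_congr rfl (by rw [Str.map_toList]) _
    · simp only [join]
      rw [Str.toList_flatten, Str.toList_map, List.flatMap_def, Str.map_toList]
    · simp only [map]
      rw [Str.map_toList, Str.toList_map]
      rfl
  · simp only [join, map, Str.map_flatten, Str.map_map, Str.flatten_flatten]

end Free

end SetOperad
namespace SetOperad

/-- Transfer the laws of an operad along a surjective map preserving all the operations. -/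
@[reducible]
def transfer {E : Type v} {E' : Type v'} (O : SetOperad E) (arity : E' → ℕ) (one : E')
    (comp : ∀ (p : E') (l : List E'), l.length = arity p → E') (push : E → E') (pull : E' → E)
    (push_pull : ∀ q, push (pull q) = q) (arity_push : ∀ p, arity (push p) = O.arity p)
    (push_one : push O.one = one)
    (push_comp : ∀ p l h, push (O.comp p l h) =
      comp (push p) (l.map push) (by rw [List.length_map, arity_push, h])) :
    SetOperad E' where
  arity := arity
  one := one
  comp := comp
  arity_one := by rw [← push_one, arity_push, O.arity_one]
  arity_comp := by
    intro p l h
    obtain ⟨p, rfl⟩ : ∃ p₀, push p₀ = p := ⟨_, push_pull p⟩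
    obtain ⟨l, rfl⟩ : ∃ l₀ : List E, l₀.map push = l :=
      ⟨l.map pull, by simp [Function.comp_def, push_pull]⟩
    rw [← push_comp p l (by rw [← arity_push, ← h, List.length_map]), arity_push, O.arity_comp,
      List.map_map]
    simp only [Function.comp_def, arity_push]
  one_comp := by
    intro q
    obtain ⟨q, rfl⟩ : ∃ q₀, push q₀ = q := ⟨_, push_pull q⟩
    subst push_one
    exact (push_comp _ [q] (by simp [O.arity_one])).symm.trans (congrArg push (O.one_comp q))
  comp_one := by
    intro p
    obtain ⟨p, rfl⟩ : ∃ p₀, push p₀ = p := ⟨_, push_pull p⟩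
    subst push_one
    have h := (push_comp p (List.replicate (O.arity p) O.one) (by simp)).symm.trans
      (congrArg push (O.comp_one p))
    simp only [List.map_replicate] at h
    simpa only [arity_push] using h
  assoc := by
    intro p L h
    obtain ⟨p, rfl⟩ : ∃ p₀, push p₀ = p := ⟨_, push_pull p⟩
    obtain ⟨L, rfl⟩ : ∃ L₀ : List {x : E × List E // x.2.length = O.arity x.1},
        L₀.map (fun x => (⟨(push x.1.1, x.1.2.map push), by
          rw [List.length_map, arity_push, x.2]⟩ :
            {x : E' × List E' // x.2.length = arity x.1})) = L := by
      refine ⟨L.map (fun x => ⟨(pull x.1.1, x.1.2.map pull), ?_⟩), ?_⟩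
      · rw [List.length_map, x.2, ← arity_push, push_pull]
      · rw [List.map_map]
        refine (List.map_congr_left ?_).trans (List.map_id L)
        rintro ⟨⟨x, l⟩, hx⟩ -
        simp [Function.comp_def, push_pull]
    have h' : L.length = O.arity p := by rw [← arity_push, ← h, List.length_map]
    have key : ∀ {p p' : E'} {l l' : List E'} (_ : p = p') (_ : l = l')
        (h : l.length = arity p) (h' : l'.length = arity p'), comp p l h = comp p' l' h' := by
      intro p p' l l' hp hl h h'
      subst hp hl
      rfl
    have e := (push_comp _ _ _).symm.trans
      ((congrArg push (O.assoc p L h')).trans (push_comp _ _ _))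
    refine Eq.trans (key ?_ ?_ _ _) (e.trans (key rfl ?_ _ _))
    · rw [push_comp]
      exact key rfl (by simp [Function.comp_def]) _ _
    · simp [List.flatMap_def, Function.comp_def, List.map_flatten]
    · rw [List.map_map, List.map_map]
      exact List.map_congr_left (fun x _ => push_comp _ _ _)

end SetOperad

/-! ## Operads in a category with finite products -/

section Operads

variable {V : Type u} [Category.{v} V] [HasFiniteProducts V]

/-- The iterated product `P(k_1) × (P(k_2) × ⋯ (P(k_n) × 1))`. -/
noncomputable def prodList (P : ℕ → V) : List ℕ → V
  | [] => ⊤_ V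
  | k :: l => P k ⨯ prodList P l

/-- The data of a (non-symmetric) operad in `V`, where the tensor product is the cartesian
product: objects `P(k)`, a unit `1 ⟶ P(1)` and composition morphisms
`P(n) × P(k_1) × ⋯ × P(k_n) ⟶ P(k_1 + ⋯ + k_n)`. -/
structure OperadData (V : Type u) [Category.{v} V] [HasFiniteProducts V] where
  obj : ℕ → V
  unit : ⊤_ V ⟶ obj 1
  comp : ∀ (n : ℕ) (l : List ℕ), l.length = n → (obj n ⨯ prodList obj l ⟶ obj l.sum)

namespace OperadData

/-- A generalised element, at stage `X`, of one of the objects `P(k)`. -/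
@[ext]
structure El (P : OperadData V) (X : V) : Type v where
  arity : ℕ
  hom : X ⟶ P.obj arity

/-- The tuple of a list of generalised elements. -/
noncomputable def tuple (P : OperadData V) {X : V} :
    ∀ l : List (P.El X), X ⟶ prodList P.obj (l.map El.arity)
  | [] => terminal.from X
  | q :: l => prod.lift q.hom (tuple P l)

/-- The identity operation, as a generalised element. -/
noncomputable def elOne (P : OperadData V) (X : V) : P.El X := ⟨1, terminal.from X ≫ P.unit⟩

/-- Composition of operations, on generalised elements. -/
noncomputable def elComp (P : OperadData V) {X : V} (p : P.El X) (l : List (P.El X))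
    (h : l.length = p.arity) : P.El X where
  arity := (l.map El.arity).sum
  hom := prod.lift p.hom (P.tuple l) ≫
    P.comp p.arity (l.map El.arity) (by rw [List.length_map, h])

end OperadData

/-- A (non-symmetric) operad in a category `V` with finite products.  The unit and
associativity axioms are stated on generalised elements; by the Yoneda lemma this is the same
as commutativity of the usual diagrams. -/
structure Operad (V : Type u) [Category.{v} V] [HasFiniteProducts V] extends OperadData V where
  one_comp : ∀ {X : V} (q : toOperadData.El X),
    toOperadData.elComp (toOperadData.elOne X) [q] rfl = q
  comp_one : ∀ {X : V} (p : toOperadData.El X),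
    toOperadData.elComp p (List.replicate p.arity (toOperadData.elOne X)) (by simp) = p
  assoc : ∀ {X : V} (p : toOperadData.El X)
    (L : List {x : toOperadData.El X × List (toOperadData.El X) // x.2.length = x.1.arity})
    (h : L.length = p.arity),
    toOperadData.elComp (toOperadData.elComp p (L.map (fun x => x.1.1)) (by simp [h]))
      (L.flatMap (fun x => x.1.2))
      (by
        rw [List.length_flatMap]
        simp only [OperadData.elComp, List.map_map]
        congr 1
        exact List.map_congr_left (fun x _ => x.2)) =
    toOperadData.elComp p (L.map (fun x => toOperadData.elComp x.1.1 x.1.2 x.2)) (by simp [h])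

namespace Operad

variable (P : Operad V)

/-- The operad of generalised elements at stage `X`. -/
noncomputable def stage (X : V) : SetOperad (P.El X) where
  arity p := p.arity
  one := P.elOne X
  comp := P.elComp
  arity_one := rfl
  arity_comp _ _ _ := rfl
  one_comp := P.one_comp
  comp_one := P.comp_one
  assoc := P.assoc

/-- Restriction of generalised elements along a morphism. -/
def elMap {X Y : V} (u : X ⟶ Y) (p : P.El Y) : P.El X := ⟨p.arity, u ≫ p.hom⟩

theorem elMap_one {X Y : V} (u : X ⟶ Y) : P.elMap u (P.elOne Y) = P.elOne X := by
  simp only [elMap, OperadData.elOne]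
  rw [← Category.assoc]
  congr 2
  exact Subsingleton.elim _ _

theorem tuple_elMap {X Y : V} (u : X ⟶ Y) (l : List (P.El Y)) :
    (⟨(l.map (P.elMap u)).map OperadData.El.arity, P.tuple (l.map (P.elMap u))⟩ :
      Σ ks : List ℕ, X ⟶ prodList P.obj ks) =
    ⟨l.map OperadData.El.arity, u ≫ P.tuple l⟩ := by
  induction l with
  | nil => exact congrArg (Sigma.mk _) (Subsingleton.elim (α := X ⟶ ⊤_ V) _ _)
  | cons q l ih =>
    have := congrArg (fun t : Σ ks : List ℕ, X ⟶ prodList P.obj ks =>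
      (⟨q.arity :: t.1, prod.lift (u ≫ q.hom) t.2⟩ :
        Σ ks : List ℕ, X ⟶ prodList P.obj ks)) ih
    refine Eq.trans this (congrArg (Sigma.mk _) ?_)
    exact (prod.comp_lift _ _ _).symm

theorem elMap_comp {X Y : V} (u : X ⟶ Y) (p : P.El Y) (l : List (P.El Y))
    (h : l.length = p.arity) :
    P.elMap u (P.elComp p l h) =
      P.elComp (P.elMap u p) (l.map (P.elMap u)) (by rw [List.length_map, h]; rfl) := by
  have key : ∀ (s t : Σ ks : List ℕ, X ⟶ prodList P.obj ks) (_ : s = t)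
      (hs : s.1.length = p.arity) (ht : t.1.length = p.arity),
      (⟨s.1.sum, prod.lift (u ≫ p.hom) s.2 ≫ P.comp p.arity s.1 hs⟩ : P.El X) =
        ⟨t.1.sum, prod.lift (u ≫ p.hom) t.2 ≫ P.comp p.arity t.1 ht⟩ := by
    rintro s t rfl hs ht
    rfl
  refine Eq.trans ?_ (key _ _ (P.tuple_elMap u l) (by simp [h]) (by simp [h])).symm
  simp only [elMap, OperadData.elComp]
  rw [← prod.comp_lift, Category.assoc]

end Operad

/-! ### The image of an operad under a product-preserving functor -/

variable {W : Type u'} [Category.{v'} W] [HasFiniteProducts W]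

/-- The canonical isomorphism `F(P(k_1) × ⋯ × P(k_n)) ≅ FP(k_1) × ⋯ × FP(k_n)`. -/
noncomputable def prodListIso (F : W ⥤ V) [PreservesFiniteProducts F] (P : ℕ → W) :
    ∀ l : List ℕ, F.obj (prodList P l) ≅ prodList (fun k => F.obj (P k)) l
  | [] => PreservesTerminal.iso F
  | k :: l => PreservesLimitPair.iso F (P k) (prodList P l) ≪≫
      prod.mapIso (Iso.refl _) (prodListIso F P l)

namespace Operad

variable (P : Operad W) (F : W ⥤ V) [PreservesFiniteProducts F]

/-- The data of the operad `FP`, given by `(FP)(k) = F(P(k))`. -/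
noncomputable def mapData : OperadData V where
  obj k := F.obj (P.obj k)
  unit := (PreservesTerminal.iso F).inv ≫ F.map P.unit
  comp n l h :=
    (PreservesLimitPair.iso F (P.obj n) (prodList P.obj l) ≪≫
      prod.mapIso (Iso.refl _) (prodListIso F P.obj l)).inv ≫ F.map (P.comp n l h)

/-- Apply `F` to a generalised element. -/
noncomputable def push {X : V} {Z : W} (f : X ⟶ F.obj Z) (p : P.El Z) : (P.mapData F).El X :=
  ⟨p.arity, f ≫ F.map p.hom⟩

theorem push_one {X : V} {Z : W} (f : X ⟶ F.obj Z) :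
    P.push F f (P.elOne Z) = (P.mapData F).elOne X := by
  refine congrArg (OperadData.El.mk (P := P.mapData F) 1) ?_
  have : f ≫ F.map (terminal.from Z) = terminal.from X ≫ (PreservesTerminal.iso F).inv := by
    rw [Iso.eq_comp_inv]
    exact Subsingleton.elim _ _
  simp only [OperadData.elOne, mapData, F.map_comp]
  rw [reassoc_of% this]

theorem lift_iso {X : V} {Z A B : W} {B' : V} (f : X ⟶ F.obj Z) (a : Z ⟶ A) (b : Z ⟶ B)
    (e : F.obj B ≅ B') :
    f ≫ F.map (prod.lift a b) ≫
        (PreservesLimitPair.iso F A B ≪≫ prod.mapIso (Iso.refl _) e).hom =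
      prod.lift (f ≫ F.map a) (f ≫ F.map b ≫ e.hom) := by
  apply Limits.prod.hom_ext
  · rw [prod.lift_fst, Iso.trans_hom, prod.mapIso_hom, PreservesLimitPair.iso_hom]
    simp only [Category.assoc, prod.map_fst, Iso.refl_hom, Category.comp_id,
      prodComparison_fst]
    rw [← F.map_comp, prod.lift_fst]
  · rw [prod.lift_snd, Iso.trans_hom, prod.mapIso_hom, PreservesLimitPair.iso_hom]
    simp only [Category.assoc, prod.map_snd]
    rw [prodComparison_snd_assoc, ← F.map_comp_assoc, prod.lift_snd]

theorem tuple_push {X : V} {Z : W} (f : X ⟶ F.obj Z) (l : List (P.El Z)) :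
    (⟨(l.map (P.push F f)).map OperadData.El.arity, (P.mapData F).tuple (l.map (P.push F f))⟩ :
      Σ ks : List ℕ, X ⟶ prodList (P.mapData F).obj ks) =
    ⟨l.map OperadData.El.arity, f ≫ F.map (P.tuple l) ≫ (prodListIso F P.obj _).hom⟩ := by
  induction l with
  | nil => exact congrArg (Sigma.mk _) (Subsingleton.elim (α := X ⟶ ⊤_ V) _ _)
  | cons q l ih =>
    have := congrArg (fun t : Σ ks : List ℕ, X ⟶ prodList (P.mapData F).obj ks =>
      (⟨q.arity :: t.1, prod.lift (f ≫ F.map q.hom) t.2⟩ :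
        Σ ks : List ℕ, X ⟶ prodList (P.mapData F).obj ks)) ih
    refine Eq.trans this (congrArg (Sigma.mk _) ?_)
    exact (lift_iso F f q.hom (P.tuple l) (prodListIso F P.obj _)).symm

theorem push_comp {X : V} {Z : W} (f : X ⟶ F.obj Z) (p : P.El Z) (l : List (P.El Z))
    (h : l.length = p.arity) :
    P.push F f (P.elComp p l h) =
      (P.mapData F).elComp (P.push F f p) (l.map (P.push F f))
        (by rw [List.length_map, h]; rfl) := by
  have key : ∀ (s t : Σ ks : List ℕ, X ⟶ prodList (P.mapData F).obj ks) (_ : s = t)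
      (hs : s.1.length = p.arity) (ht : t.1.length = p.arity),
      (⟨s.1.sum, prod.lift (f ≫ F.map p.hom) s.2 ≫ (P.mapData F).comp p.arity s.1 hs⟩ :
        (P.mapData F).El X) =
      ⟨t.1.sum, prod.lift (f ≫ F.map p.hom) t.2 ≫ (P.mapData F).comp p.arity t.1 ht⟩ := by
    rintro s t rfl hs ht
    rfl
  refine Eq.trans ?_ (key _ _ (P.tuple_push F f l) (by simp [h]) (by simp [h])).symm
  refine congrArg (OperadData.El.mk (P := P.mapData F) _) ?_
  simp only [OperadData.elComp, mapData]
  rw [← Category.assoc, F.map_comp, ← Category.assoc]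
  congr 1
  rw [Iso.eq_comp_inv, Category.assoc]
  exact lift_iso F f p.hom (P.tuple l) (prodListIso F P.obj _)

/-- The operad laws of `FP`, at stage `X`. -/
noncomputable def mapStage [F.IsRightAdjoint] (X : V) : SetOperad ((P.mapData F).El X) :=
  (P.stage (F.leftAdjoint.obj X)).transfer (fun p => p.arity) ((P.mapData F).elOne X)
    (P.mapData F).elComp
    (P.push F ((Adjunction.ofIsRightAdjoint F).unit.app X))
    (fun q => ⟨q.arity, ((Adjunction.ofIsRightAdjoint F).homEquiv X _).symm q.hom⟩)
    (fun q => congrArg (OperadData.El.mk (P := P.mapData F) q.arity)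
      ((Adjunction.homEquiv_unit _ _ _ _).symm.trans (Equiv.apply_symm_apply _ _)))
    (fun _ => rfl) (P.push_one F _) (P.push_comp F _)

/-- The operad `FP` in `V` given by `(FP)(k) = F(P(k))`, where `P` is an operad in `W` and
`F : W ⥤ V` preserves finite products.  (`F` is assumed to be a right adjoint, which makes
the proof of the laws shorter.) -/
noncomputable def map [F.IsRightAdjoint] : Operad V where
  toOperadData := P.mapData F
  one_comp {X} := (P.mapStage F X).one_comp
  comp_one {X} := (P.mapStage F X).comp_one
  assoc {X} := (P.mapStage F X).assoc

end Operad

end Operads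
/-! ## Categories enriched in `V` and weakened by an operad -/

section PCategories

variable {V : Type u} [Category.{v} V] [HasFiniteProducts V]

namespace VGraph

/-- The product `A(a_{k-1}, a_k) × (⋯ × (A(a_0, a_1) × 1))` for a sequence of objects
`a = a_0, ..., a_k = b`, regarded as a string `s` in the graph with exactly one arrow between
any two objects. -/
noncomputable def prodHom (A : VGraph.{w} V) {a : A.obj} :
    ∀ {b : A.obj}, Str (fun _ _ : A.obj => PUnit.{1}) a b → V
  | _, Str.nil => ⊤_ V
  | _, Str.cons (b := b) (c := c) _ s => A.hom b c ⨯ prodHom A s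

/-- The product `u × m` of a morphism of hom-objects and a morphism of products. -/
noncomputable def consMap {A B : VGraph.{w} V} {a b c : A.obj} {a' b' c' : B.obj}
    (u : A.hom b c ⟶ B.hom b' c') {s : Str (fun _ _ : A.obj => PUnit.{1}) a b}
    {s' : Str (fun _ _ : B.obj => PUnit.{1}) a' b'} (m : A.prodHom s ⟶ B.prodHom s') :
    A.prodHom (Str.cons (c := c) PUnit.unit s) ⟶ B.prodHom (Str.cons (c := c') PUnit.unit s') :=
  prod.map u m

/-- The morphism `F × ⋯ × F` induced by a morphism `F` of `V`-graphs. -/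
noncomputable def prodHomMap {A B : VGraph.{w} V} (F : A ⟶ B) {a : A.obj} :
    ∀ {b : A.obj} (s : Str (fun _ _ : A.obj => PUnit.{1}) a b),
      A.prodHom s ⟶ B.prodHom (s.map F.obj (fun _ _ x => x))
  | _, Str.nil => 𝟙 _
  | _, Str.cons (b := b) (c := c) _ s => consMap (F.hom b c) (prodHomMap F s)

/-- The sequence of objects underlying a string of arrows. -/
def shape {S : Type w} {H : S → S → Type v} {a b : S} (s : Str H a b) :
    Str (fun _ _ : S => PUnit.{1}) a b :=
  s.map (fun a => a) (fun _ _ _ => PUnit.unit)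

/-- The tuple of a string of generalised elements of hom-objects. -/
noncomputable def tuple (A : VGraph.{w} V) {X : V} {a : A.obj} :
    ∀ {b : A.obj} (s : Str (fun a b : A.obj => X ⟶ A.hom a b) a b), X ⟶ A.prodHom (shape s)
  | _, Str.nil => terminal.from X
  | _, Str.cons f s => prod.lift f (tuple A s)

end VGraph

/-- The data of a `(V, P)`-category: a `V`-graph `A` and composition morphisms
`P(k) × A(a_{k-1}, a_k) × ⋯ × A(a_0, a_1) ⟶ A(a_0, a_k)`. -/
structure PCategoryData (P : Operad V) extends VGraph.{w} V where
  comp : ∀ (k : ℕ) {a b : obj} (s : Str (fun _ _ : obj => PUnit.{1}) a b), s.length = k →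
    (P.obj k ⨯ toVGraph.prodHom s ⟶ hom a b)

/-- Composition on generalised elements: the composite, parametrised by a generalised element
of `P(k)`, of a string of `k` generalised elements of hom-objects. -/
noncomputable def PCategoryData.act {P : Operad V} (A : PCategoryData.{w} P) {X : V}
    {a b : A.obj} (x : (P.stage X).Free (fun a b : A.obj => X ⟶ A.hom a b) a b) :
    X ⟶ A.hom a b :=
  prod.lift x.op.hom (A.tuple x.str) ≫
    A.comp x.op.arity (VGraph.shape x.str) (by rw [VGraph.shape, Str.length_map]; exact x.length_eq)

/-- A `(V, P)`-category.  Compatibility with the unit and the composition of the operad is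
stated on generalised elements; by the Yoneda lemma this is the same as commutativity of the
usual diagrams. -/
structure PCategory (P : Operad V) extends PCategoryData.{w} P where
  act_pure : ∀ {X : V} {a b : obj} (f : X ⟶ hom a b),
    toPCategoryData.act (SetOperad.Free.pure (P.stage X) f) = f
  act_join : ∀ {X : V} {a b : obj}
    (x : (P.stage X).Free (fun a b => (P.stage X).Free (fun a b : obj => X ⟶ hom a b) a b) a b),
    toPCategoryData.act x.join =
      toPCategoryData.act (x.map (O' := P.stage X) (fun p => p) (fun _ => rfl) (fun a => a)
        (fun _ _ y => toPCategoryData.act y))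

namespace PCategory

/-- A morphism of `(V, P)`-categories: a morphism of the underlying `V`-graphs commuting with
all the composition morphisms. -/
@[ext]
structure Hom {P : Operad V} (A B : PCategory.{w} P) where
  graph : A.toVGraph ⟶ B.toVGraph
  comm : ∀ (k : ℕ) {a b : A.obj} (s : Str (fun _ _ : A.obj => PUnit.{1}) a b)
    (h : s.length = k),
    A.comp k s h ≫ graph.hom a b =
      prod.map (𝟙 (P.obj k)) (VGraph.prodHomMap graph s) ≫
        B.comp k (s.map graph.obj (fun _ _ x => x)) (by rw [Str.length_map, h])

theorem prodHomMap_id (A : VGraph.{w} V) {a b : A.obj}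
    (s : Str (fun _ _ : A.obj => PUnit.{1}) a b) :
    (⟨s.map (fun a => a) (fun _ _ x => x), VGraph.prodHomMap (𝟙 A) s⟩ :
      Σ t : Str (fun _ _ : A.obj => PUnit.{1}) a b, A.prodHom s ⟶ A.prodHom t) =
    ⟨s, 𝟙 _⟩ := by
  induction s with
  | nil => rfl
  | @cons b c f s ih =>
    have := congrArg (fun t : Σ t : Str (fun _ _ : A.obj => PUnit.{1}) a b,
      A.prodHom s ⟶ A.prodHom t =>
      (⟨Str.cons (c := c) f t.1, VGraph.consMap (𝟙 (A.hom b c)) t.2⟩ :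
        Σ t : Str (fun _ _ : A.obj => PUnit.{1}) a c,
          A.prodHom (Str.cons f s) ⟶ A.prodHom t)) ih
    exact this.trans (congrArg (Sigma.mk _) prod.map_id_id)

theorem prodHomMap_comp {A B D : VGraph.{w} V} (F : A ⟶ B) (G : B ⟶ D) {a b : A.obj}
    (s : Str (fun _ _ : A.obj => PUnit.{1}) a b) :
    (⟨s.map (F ≫ G).obj (fun _ _ x => x), VGraph.prodHomMap (F ≫ G) s⟩ :
      Σ t : Str (fun _ _ : D.obj => PUnit.{1}) ((F ≫ G).obj a) ((F ≫ G).obj b),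
        A.prodHom s ⟶ D.prodHom t) =
    ⟨(s.map F.obj (fun _ _ x => x)).map G.obj (fun _ _ x => x),
      VGraph.prodHomMap F s ≫ VGraph.prodHomMap G _⟩ := by
  induction s with
  | nil => exact congrArg (Sigma.mk _) (Category.comp_id _).symm
  | @cons b c f s ih =>
    have := congrArg (fun t : Σ t : Str (fun _ _ : D.obj => PUnit.{1}) ((F ≫ G).obj a)
        ((F ≫ G).obj b), A.prodHom s ⟶ D.prodHom t =>
      (⟨Str.cons f t.1, VGraph.consMap (F.hom b c ≫ G.hom _ _) t.2⟩ :
        Σ t : Str (fun _ _ : D.obj => PUnit.{1}) ((F ≫ G).obj a) ((F ≫ G).obj c),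
          A.prodHom (Str.cons f s) ⟶ D.prodHom t)) ih
    exact this.trans (congrArg (Sigma.mk _) (prod.map_map _ _ _ _).symm)

instance (P : Operad V) : Category (PCategory.{w} P) where
  Hom A B := Hom A B
  id A :=
    { graph := 𝟙 A.toVGraph
      comm := by
        intro k a b s h
        have key : ∀ (t t' : Σ t : Str (fun _ _ : A.obj => PUnit.{1}) a b,
            A.prodHom s ⟶ A.prodHom t) (_ : t = t') (h : t.1.length = k)
            (h' : t'.1.length = k),
            prod.map (𝟙 (P.obj k)) t.2 ≫ A.comp k t.1 h =
              prod.map (𝟙 (P.obj k)) t'.2 ≫ A.comp k t'.1 h' := by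
          rintro t t' rfl h h'
          rfl
        refine Eq.trans ?_ (key _ _ (prodHomMap_id A.toVGraph s)
          (by rw [Str.length_map, h]) h).symm
        rw [prod.map_id_id, Category.id_comp]
        exact Category.comp_id _ }
  comp {A B D} F G :=
    { graph := F.graph ≫ G.graph
      comm := by
        intro k a b s h
        have key : ∀ (t t' : Σ t : Str (fun _ _ : D.obj => PUnit.{1})
            ((F.graph ≫ G.graph).obj a) ((F.graph ≫ G.graph).obj b),
            A.prodHom s ⟶ D.prodHom t) (_ : t = t') (h : t.1.length = k)
            (h' : t'.1.length = k),
            prod.map (𝟙 (P.obj k)) t.2 ≫ D.comp k t.1 h =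
              prod.map (𝟙 (P.obj k)) t'.2 ≫ D.comp k t'.1 h' := by
          rintro t t' rfl h h'
          rfl
        refine Eq.trans ?_ (key _ _ (prodHomMap_comp F.graph G.graph s)
          (by rw [Str.length_map, h]) (by rw [Str.length_map, Str.length_map, h])).symm
        have e := G.comm k (s.map F.graph.obj (fun _ _ x => x)) (by rw [Str.length_map, h])
        have e' : A.comp k s h ≫ (F.graph ≫ G.graph).hom a b =
          (A.comp k s h ≫ F.graph.hom a b) ≫ G.graph.hom _ _ := (Category.assoc _ _ _).symm
        rw [e', F.comm k s h, Category.assoc, e, ← Category.assoc, prod.map_map,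
          Category.id_comp] }

/-- The forgetful functor from `(V, P)`-categories to `V`-graphs. -/
def forget (P : Operad V) : PCategory.{w} P ⥤ VGraph.{w} V where
  obj A := A.toVGraph
  map F := F.graph

end PCategory

end PCategories
/-! ## The free `(V, P)`-category monad for a presheaf category `V` -/

section Free

namespace SetOperad.Free

variable {E : Type*} {O : SetOperad E} {E' : Type*} {O' : SetOperad E'}
  {S : Type*} {H : S → S → Type*} {S' : Type*} {H' : S' → S' → Type*}

theorem map_id {a b : S} (x : O.Free H a b) :
    x.map (O' := O) (fun p => p) (fun _ => rfl) (fun a => a) (fun _ _ f => f) = x :=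
  Free.ext rfl (Str.map_id _)

theorem map_map {E'' : Type*} {O'' : SetOperad E''} {S'' : Type*} {H'' : S'' → S'' → Type*}
    (φ : E → E') (hφ : ∀ p, O'.arity (φ p) = O.arity p)
    (φ' : E' → E'') (hφ' : ∀ p, O''.arity (φ' p) = O'.arity p)
    (g : S → S') (F : ∀ a b, H a b → H' (g a) (g b))
    (g' : S' → S'') (F' : ∀ a b, H' a b → H'' (g' a) (g' b)) {a b : S} (x : O.Free H a b) :
    (x.map φ hφ g F).map φ' hφ' g' F' =
      x.map (O' := O'') (fun p => φ' (φ p)) (fun p => (hφ' _).trans (hφ p)) (fun a => g' (g a))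
        (fun _ _ f => F' _ _ (F _ _ f)) :=
  Free.ext rfl (Str.map_map _ _ _ _ _)

theorem map_pure (φ : E → E') (hφ : ∀ p, O'.arity (φ p) = O.arity p) (h1 : φ O.one = O'.one)
    (g : S → S') (F : ∀ a b, H a b → H' (g a) (g b)) {a b : S} (f : H a b) :
    (pure O f).map φ hφ g F = pure O' (F _ _ f) :=
  Free.ext h1 rfl

theorem map_join (φ : E → E') (hφ : ∀ p, O'.arity (φ p) = O.arity p)
    (hc : ∀ p l h, φ (O.comp p l h) =
      O'.comp (φ p) (l.map φ) (by rw [List.length_map, hφ, h]))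
    (g : S → S') (F : ∀ a b, H a b → H' (g a) (g b)) {a b : S}
    (x : O.Free (fun a b => O.Free H a b) a b) :
    x.join.map φ hφ g F =
      (x.map (O' := O') (H' := fun a b => O'.Free H' a b) φ hφ g
        (fun _ _ y => y.map φ hφ g F)).join := by
  refine Free.ext ?_ ?_
  · refine (hc _ _ _).trans (O'.comp_congr rfl ?_ _)
    simp only [map]
    rw [Str.map_toList, Str.toList_map]
  · simp only [map, join, Str.map_flatten, Str.map_map]

end SetOperad.Free

variable {C : Type w} [SmallCategory C]

namespace Operad

/-- A section at `c` of one of the presheaves `P(k)`. -/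
@[ext]
structure Sec (P : Operad (Cᵒᵖ ⥤ Type w)) (c : Cᵒᵖ) : Type w where
  arity : ℕ
  val : (P.obj arity).obj c

variable (P : Operad (Cᵒᵖ ⥤ Type w))

/-- The section corresponding to a generalised element at a representable stage. -/
def toSec {c : Cᵒᵖ} (p : P.El (yoneda.obj c.unop)) : P.Sec c :=
  ⟨p.arity, yonedaEquiv p.hom⟩

/-- The generalised element at a representable stage corresponding to a section. -/
def ofSec {c : Cᵒᵖ} (p : P.Sec c) : P.El (yoneda.obj c.unop) :=
  ⟨p.arity, yonedaEquiv.symm p.val⟩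

theorem toSec_ofSec {c : Cᵒᵖ} (p : P.Sec c) : P.toSec (P.ofSec p) = p := by
  simp only [toSec, ofSec]
  exact congrArg (Sec.mk p.arity) (yonedaEquiv.apply_symm_apply p.val)

theorem ofSec_toSec {c : Cᵒᵖ} (p : P.El (yoneda.obj c.unop)) : P.ofSec (P.toSec p) = p := by
  simp only [toSec, ofSec]
  exact congrArg (OperadData.El.mk p.arity) (yonedaEquiv.symm_apply_apply p.hom)

/-- The operad structure on the sections at `c`. -/
noncomputable def sec (c : Cᵒᵖ) : SetOperad (P.Sec c) :=
  (P.stage (yoneda.obj c.unop)).transfer (fun p => p.arity) (P.toSec (P.elOne _))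
    (fun p l h => P.toSec (P.elComp (P.ofSec p) (l.map P.ofSec) (by rw [List.length_map, h]; rfl)))
    P.toSec P.ofSec P.toSec_ofSec (fun _ => rfl) rfl
    (by
      intro p l h
      have key : ∀ {p p' : P.El (yoneda.obj c.unop)} {l l' : List (P.El (yoneda.obj c.unop))}
          (_ : p = p') (_ : l = l') (h : l.length = p.arity) (h' : l'.length = p'.arity),
          P.toSec (P.elComp p l h) = P.toSec (P.elComp p' l' h') := by
        rintro p p' l l' rfl rfl h h'
        rfl
      refine key (P.ofSec_toSec p).symm ?_ h _
      rw [List.map_map]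
      exact ((List.map_congr_left (fun x _ => P.ofSec_toSec x)).trans (List.map_id l)).symm)

/-- Restriction of sections. -/
def secMap {c c' : Cᵒᵖ} (f : c ⟶ c') (p : P.Sec c) : P.Sec c' :=
  ⟨p.arity, (P.obj p.arity).map f p.val⟩

theorem toSec_elMap {c c' : Cᵒᵖ} (f : c ⟶ c') (p : P.El (yoneda.obj c.unop)) :
    P.toSec (P.elMap (yoneda.map f.unop) p) = P.secMap f (P.toSec p) :=
  congrArg (Sec.mk p.arity) (yonedaEquiv_naturality' p.hom f).symm

theorem ofSec_secMap {c c' : Cᵒᵖ} (f : c ⟶ c') (p : P.Sec c) :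
    P.ofSec (P.secMap f p) = P.elMap (yoneda.map f.unop) (P.ofSec p) :=
  congrArg (OperadData.El.mk p.arity) (yonedaEquiv_symm_map f p.val)

theorem secMap_one {c c' : Cᵒᵖ} (f : c ⟶ c') : P.secMap f (P.sec c).one = (P.sec c').one := by
  refine (P.toSec_elMap f _).symm.trans ?_
  rw [elMap_one]
  rfl

theorem secMap_comp {c c' : Cᵒᵖ} (f : c ⟶ c') (p : P.Sec c) (l : List (P.Sec c))
    (h : l.length = p.arity) :
    P.secMap f ((P.sec c).comp p l h) =
      (P.sec c').comp (P.secMap f p) (l.map (P.secMap f)) (by rw [List.length_map, h]; rfl) := by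
  refine (P.toSec_elMap f _).symm.trans ?_
  rw [elMap_comp]
  have key : ∀ {p p' : P.El (yoneda.obj c'.unop)} {l l' : List (P.El (yoneda.obj c'.unop))}
      (_ : p = p') (_ : l = l') (h : l.length = p.arity) (h' : l'.length = p'.arity),
      P.toSec (P.elComp p l h) = P.toSec (P.elComp p' l' h') := by
    rintro p p' l l' rfl rfl h h'
    rfl
  refine key (P.ofSec_secMap f p).symm ?_ _ _
  rw [List.map_map, List.map_map]
  exact List.map_congr_left (fun x _ => (P.ofSec_secMap f x).symm)

theorem secMap_id {c : Cᵒᵖ} (p : P.Sec c) : P.secMap (𝟙 c) p = p :=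
  congrArg (Sec.mk p.arity) (by simp)

theorem secMap_secMap {c c' c'' : Cᵒᵖ} (f : c ⟶ c') (g : c' ⟶ c'') (p : P.Sec c) :
    P.secMap (f ≫ g) p = P.secMap g (P.secMap f p) :=
  congrArg (Sec.mk p.arity) ((P.obj p.arity).map_comp_apply f g p.val)

/-- The hom-object of the free `(V, P)`-category on `A`: the coproduct, computed pointwise, of
the products `P(k) × A(a_{k-1}, a_k) × ⋯ × A(a_0, a_1)` over all `k ≥ 0` and all sequences
`a = a_0, ..., a_k = b` of objects. -/
noncomputable def fcHom (A : VGraph.{w} (Cᵒᵖ ⥤ Type w)) (a b : A.obj) : Cᵒᵖ ⥤ Type w where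
  obj c := (P.sec c).Free (fun a b : A.obj => (A.hom a b).obj c) a b
  map {c c'} f := ↾(fun x => x.map (O' := P.sec c') (P.secMap f) (fun _ => rfl) (fun a => a)
    (fun a b => (A.hom a b).map f))
  map_id c := by
    apply ConcreteCategory.hom_ext
    intro x
    refine SetOperad.Free.ext (P.secMap_id x.op) (Eq.trans ?_ (Str.map_id x.str))
    change x.str.map _ _ = _
    congr 1
    funext a b f
    simp
  map_comp {c c' c''} f g := by
    apply ConcreteCategory.hom_ext
    intro x
    refine SetOperad.Free.ext (P.secMap_secMap f g x.op) ?_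
    change x.str.map (fun a => a) (fun a b => (A.hom a b).map (f ≫ g)) =
      (x.str.map (H' := fun a b => (A.hom a b).obj c') (fun a => a)
        (fun a b => (A.hom a b).map f)).map (fun a => a) (fun a b => (A.hom a b).map g)
    rw [Str.map_map]
    congr 1
    funext a b h
    simp

/-- The free `(V, P)`-category functor on `V`-graphs, the identity on objects. -/
noncomputable def fcFunctor : VGraph.{w} (Cᵒᵖ ⥤ Type w) ⥤ VGraph.{w} (Cᵒᵖ ⥤ Type w) where
  obj A := ⟨A.obj, P.fcHom A⟩
  map {A B} F := ⟨F.obj, fun a b =>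
    { app := fun c => ↾(fun x => x.map (O' := P.sec c) (fun p => p) (fun _ => rfl) F.obj
        (fun a b => (F.hom a b).app c))
      naturality := by
        intro c c' f
        apply ConcreteCategory.hom_ext
        intro x
        refine SetOperad.Free.ext rfl ?_
        change (x.str.map (H' := fun a b => (A.hom a b).obj c') (fun a => a)
            (fun a b => (A.hom a b).map f)).map F.obj (fun a b => (F.hom a b).app c') =
          (x.str.map (H' := fun a b => (B.hom a b).obj c) F.obj
            (fun a b => (F.hom a b).app c)).map (fun a => a) (fun a b => (B.hom a b).map f)
        rw [Str.map_map, Str.map_map]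
        congr 1
        funext a b h
        exact NatTrans.naturality_apply (F.hom a b) f h }⟩
  map_id A := by
    refine VGraph.Hom.ext rfl (heq_of_eq ?_)
    funext a b
    apply NatTrans.ext
    funext c
    apply ConcreteCategory.hom_ext
    intro x
    exact SetOperad.Free.map_id x
  map_comp {A B D} F G := by
    refine VGraph.Hom.ext rfl (heq_of_eq ?_)
    funext a b
    apply NatTrans.ext
    funext c
    apply ConcreteCategory.hom_ext
    intro x
    exact (SetOperad.Free.map_map (O := P.sec c) (O' := P.sec c) (O'' := P.sec c)
      (H := fun a b => (A.hom a b).obj c) (H' := fun a b => (B.hom a b).obj c)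
      (H'' := fun a b => (D.hom a b).obj c) (fun p => p) (fun _ => rfl) (fun p => p) (fun _ => rfl) F.obj
      (fun a b => (F.hom a b).app c) G.obj (fun a b => (G.hom a b).app c) x).symm

/-- The free `(V, P)`-category monad `fc_{(V, P)}` on `V`-graphs. -/
noncomputable def fc : Monad (VGraph.{w} (Cᵒᵖ ⥤ Type w)) where
  toFunctor := P.fcFunctor
  η :=
    { app := fun A => ⟨fun a => a, fun a b =>
        { app := fun c => ↾(fun x => SetOperad.Free.pure (P.sec c) x)
          naturality := by
            intro c c' f
            apply ConcreteCategory.hom_ext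
            intro x
            exact (SetOperad.Free.map_pure (H := fun a b : A.obj => (A.hom a b).obj c)
              (H' := fun a b : A.obj => (A.hom a b).obj c') (O := P.sec c)
              (O' := P.sec c') (P.secMap f) (fun _ => rfl) (P.secMap_one f) _
              (fun a b => (A.hom a b).map f) x).symm }⟩
      naturality := by
        intro A B F
        refine VGraph.Hom.ext rfl (heq_of_eq ?_)
        funext a b
        apply NatTrans.ext
        funext c
        apply ConcreteCategory.hom_ext
        intro x
        rfl }
  μ :=
    { app := fun A => ⟨fun a => a, fun a b =>
        { app := fun c => ↾(fun x => SetOperad.Free.join x)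
          naturality := by
            intro c c' f
            apply ConcreteCategory.hom_ext
            intro x
            exact (SetOperad.Free.map_join (H := fun a b : A.obj => (A.hom a b).obj c)
              (H' := fun a b : A.obj => (A.hom a b).obj c') (O := P.sec c) (O' := P.sec c')
              _ (fun _ => rfl) (P.secMap_comp f) _
              (fun a b => (A.hom a b).map f) x).symm }⟩
      naturality := by
        intro A B F
        refine VGraph.Hom.ext rfl (heq_of_eq ?_)
        funext a b
        apply NatTrans.ext
        funext c
        apply ConcreteCategory.hom_ext
        intro x
        refine (SetOperad.Free.map_join (O := P.sec c) (O' := P.sec c) _ _ ?_ _ _ x).symm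
        intro p l h
        exact (P.sec c).comp_congr rfl (List.map_id l).symm h }
  assoc A := by
    refine VGraph.Hom.ext rfl (heq_of_eq ?_)
    funext a b
    apply NatTrans.ext
    funext c
    apply ConcreteCategory.hom_ext
    intro x
    exact (SetOperad.Free.join_join x).symm
  left_unit A := by
    refine VGraph.Hom.ext rfl (heq_of_eq ?_)
    funext a b
    apply NatTrans.ext
    funext c
    apply ConcreteCategory.hom_ext
    intro x
    exact SetOperad.Free.join_pure x
  right_unit A := by
    refine VGraph.Hom.ext rfl (heq_of_eq ?_)
    funext a b
    apply NatTrans.ext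
    funext c
    apply ConcreteCategory.hom_ext
    intro x
    exact SetOperad.Free.join_map_pure x

end Operad

end Free

/-! ## Operads in categories of algebras -/

section Algebras

variable {V : Type u} [Category.{v} V] [HasFiniteProducts V]

/-- Categories of algebras have finite products, created by the forgetful functor. -/
instance hasFiniteProducts_algebra (T : Monad V) : HasFiniteProducts T.Algebra where
  out _ := hasLimitsOfShape_of_hasLimitsOfShape_createsLimitsOfShape T.forget

instance preservesFiniteProducts_forget (T : Monad V) : PreservesFiniteProducts T.forget where
  preserves _ := inferInstance

/-- The underlying operad `UP` in `V` of an operad `P` in the category `V^T` of `T`-algebras,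
with `(UP)(k) = U(P(k))` for `U : V^T ⥤ V` the forgetful functor. -/
noncomputable def Operad.underlying (T : Monad V) (P : Operad T.Algebra) : Operad V :=
  P.map T.forget

end Algebras

/-! By Beck's theorem, an algebra for the composite of two monads along a distributive law is an
object with an action of each monad, the two actions being compatible through the law. Here an
action of `T_*` puts a `T`-algebra structure on every hom-object, an action of `fc` supplies
composition morphisms satisfying the laws of `UP`, and compatibility says that these composition
morphisms are homomorphisms of algebras. Together these are exactly the data of a `(V^T,
P)`-category. `FcAlgebra` packages the two actions and serves as the halfway point of the
isomorphism.

On the summand `P(k) × A(a_{k-1},a_k) × ⋯ × A(a_0,a_1)` the law applies `T`, compares `T` of the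
product with the product of the values of `T`, and then uses the algebra structure `T P(k) ⟶ P(k)`.
Since `T` preserves coproducts, this determines the law on all of `T(fc A)`. Its axioms for `T_*`
reduce to the axioms of the algebras `P(k)`; its axioms for `fc` hold because the unit and
composition of `P` are homomorphisms of algebras.

The computation is done with cells: a cell at stage `X` is a generalised element of some `P(k)`
together with a string of `k` generalised elements of hom-objects. A morphism `X ⟶ fc A` whose
values all pass through the same sequence of objects is a cell (`exists_cells`). Hence, for a
coproduct-preserving functor `G`, morphisms out of `G (fc A)` can be compared on cells
(`map_fcHom_hom_ext`) and defined by natural operations on cells (`exists_map_fcHom_desc`).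
Composition in `fc` is treated likewise with cells of cells (`map_fcHom_fcHom_hom_ext`). Cells at
presheaf stages and cells at algebra stages are related by the free-forgetful adjunction, through
`Cells.under` and `Cells.lift`. -/

namespace DistributiveLaw

variable {E : Type u} [Category.{v} E] {S T : Monad E}

/-! ### Algebras for the composite monad -/

section Decompose

variable (d : DistributiveLaw S T) (X : d.composite.Algebra)

/-- The structure morphism of an algebra of the composite monad. -/
def structureMap : T.obj (S.obj X.A) ⟶ X.A := X.a

/-- The action of `S` on an algebra of the composite monad. -/
def actLeft : S.obj X.A ⟶ X.A := T.η.app (S.obj X.A) ≫ d.structureMap X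

/-- The action of `T` on an algebra of the composite monad. -/
def actRight : T.obj X.A ⟶ X.A := T.map (S.η.app X.A) ≫ d.structureMap X

theorem algebra_unit : S.η.app X.A ≫ T.η.app (S.obj X.A) ≫ d.structureMap X = 𝟙 X.A :=
  (Category.assoc _ _ _).symm.trans X.unit

theorem algebra_assoc :
    T.map (S.map (d.structureMap X)) ≫ d.structureMap X =
      T.map (d.law.app (S.obj X.A)) ≫ T.μ.app (S.obj (S.obj X.A)) ≫
        T.map (S.μ.app X.A) ≫ d.structureMap X := by
  have h : (T.map (d.law.app (S.obj X.A)) ≫ T.μ.app (S.obj (S.obj X.A)) ≫ T.map (S.μ.app X.A)) ≫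
      (d.structureMap X) = T.map (S.map (d.structureMap X)) ≫ d.structureMap X := X.assoc
  rw [← h]
  simp only [Category.assoc]

theorem unit_actLeft : S.η.app X.A ≫ d.actLeft X = 𝟙 X.A := d.algebra_unit X

theorem unit_actRight : T.η.app X.A ≫ d.actRight X = 𝟙 X.A := by
  have h := T.η.naturality (S.η.app X.A)
  dsimp at h
  rw [actRight, ← reassoc_of% h, d.algebra_unit X]

theorem assoc_actLeft :
    S.μ.app X.A ≫ d.actLeft X = S.map (d.actLeft X) ≫ d.actLeft X := by
  have h1 := T.η.naturality (S.map (d.structureMap X))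
  have h2 := T.η.naturality (d.law.app (S.obj X.A))
  have h3 := T.left_unit (S.obj (S.obj X.A))
  have h4 := d.unit_right (S.obj X.A)
  have h5 := T.η.naturality (S.μ.app X.A)
  dsimp at h1 h2 h3 h4 h5
  simp only [actLeft, Functor.map_comp, Category.assoc]
  rw [reassoc_of% h1, d.algebra_assoc, ← reassoc_of% h2, reassoc_of% h3, reassoc_of% h4,
    reassoc_of% h5]

theorem assoc_actRight :
    T.μ.app X.A ≫ d.actRight X = T.map (d.actRight X) ≫ d.actRight X := by
  have h1 := S.η.naturality (d.structureMap X)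
  have h2 := d.unit_left (S.obj X.A)
  have h3 : T.map (S.η.app (S.obj X.A)) ≫ T.map (S.μ.app X.A) = 𝟙 (T.obj (S.obj X.A)) := by
    rw [← T.map_comp, S.left_unit]
    exact T.map_id _
  have h4 := T.μ.naturality (S.η.app (S.obj X.A))
  have h5 := T.μ.naturality (S.η.app X.A)
  dsimp at h1 h2 h4 h5
  simp only [actRight, Functor.map_comp, Category.assoc]
  rw [← T.map_comp_assoc (d.structureMap X), h1, T.map_comp_assoc, d.algebra_assoc,
    ← T.map_comp_assoc (S.η.app _), h2, reassoc_of% h4, reassoc_of% h3,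
    reassoc_of% h5]

/-- The two actions lose no information. Associativity of the algebra, applied after inserting both
units, leaves a composite in which the law meets a unit and disappears, and the remaining units
cancel against the multiplications. -/
theorem map_actLeft_actRight : T.map (d.actLeft X) ≫ d.actRight X = (d.structureMap X) := by
  have h1 := S.η.naturality (d.structureMap X)
  have h2 := d.unit_left (S.obj X.A)
  have h3 : T.map (S.η.app (S.obj X.A)) ≫ T.map (S.μ.app X.A) = 𝟙 (T.obj (S.obj X.A)) := by
    rw [← T.map_comp, S.left_unit]
    exact T.map_id _
  have h4 := T.μ.naturality (S.η.app (S.obj X.A))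
  have h5 := T.right_unit (S.obj X.A)
  dsimp at h1 h2 h4 h5
  simp only [actLeft, actRight, Functor.map_comp, Category.assoc]
  rw [← T.map_comp_assoc (d.structureMap X), h1, T.map_comp_assoc, d.algebra_assoc,
    ← T.map_comp_assoc (S.η.app _), h2, reassoc_of% h4, reassoc_of% h3,
    reassoc_of% h5]

/-- Beck's compatibility condition. By `map_actLeft_actRight` the right side is the law followed by
the structure morphism, which is also what associativity of the algebra yields on the left. -/
theorem map_actRight_actLeft :
    S.map (d.actRight X) ≫ d.actLeft X =
      d.law.app X.A ≫ T.map (d.actLeft X) ≫ d.actRight X := by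
  rw [map_actLeft_actRight]
  have h1 := T.η.naturality (S.map (d.structureMap X))
  have h2 := T.η.naturality (d.law.app (S.obj X.A))
  have h3 := T.left_unit (S.obj (S.obj X.A))
  have h4 := d.law_naturality (S.η.app X.A)
  have h5 := S.right_unit X.A
  dsimp at h1 h2 h3 h4 h5
  simp only [actLeft, actRight, Functor.map_comp, Category.assoc]
  rw [reassoc_of% h1, d.algebra_assoc, ← reassoc_of% h2, reassoc_of% h3, reassoc_of% h4,
    ← T.map_comp_assoc, h5, T.map_id, Category.id_comp]

variable {X} {Y : d.composite.Algebra}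

theorem hom_actLeft (f : X ⟶ Y) : S.map f.f ≫ d.actLeft Y = d.actLeft X ≫ f.f := by
  have h1 := T.η.naturality (S.map f.f)
  have h2 : T.map (S.map f.f) ≫ d.structureMap Y = (d.structureMap X) ≫ f.f := f.h
  dsimp at h1
  simp only [actLeft, Category.assoc]
  rw [reassoc_of% h1, h2]

theorem hom_actRight (f : X ⟶ Y) : T.map f.f ≫ d.actRight Y = d.actRight X ≫ f.f := by
  have h1 := S.η.naturality f.f
  have h2 : T.map (S.map f.f) ≫ d.structureMap Y = (d.structureMap X) ≫ f.f := f.h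
  dsimp at h1
  simp only [actRight, Category.assoc]
  rw [← T.map_comp_assoc, h1, T.map_comp_assoc, h2]

end Decompose

/-! ### Gluing two compatible actions -/

section Assemble

variable (d : DistributiveLaw S T) {A : E} (α : S.obj A ⟶ A) (β : T.obj A ⟶ A)

/-- An algebra of the composite monad, from compatible actions of `S` and `T`. -/
def algebraMk (hα : S.η.app A ≫ α = 𝟙 A) (hα' : S.μ.app A ≫ α = S.map α ≫ α)
    (hβ : T.η.app A ≫ β = 𝟙 A) (hβ' : T.μ.app A ≫ β = T.map β ≫ β)
    (h : S.map β ≫ α = d.law.app A ≫ T.map α ≫ β) : d.composite.Algebra where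
  A := A
  a := T.map α ≫ β
  unit := by
    have h1 := T.η.naturality α
    dsimp at h1
    change (S.η.app A ≫ T.η.app (S.obj A)) ≫ T.map α ≫ β = _
    rw [Category.assoc, ← reassoc_of% h1, reassoc_of% hα, hβ]
  assoc := by
    have h1 := d.law_naturality α
    have h2 := T.μ.naturality (S.map α)
    have h3 := T.μ.naturality α
    dsimp at h1 h2 h3
    change (T.map (d.law.app (S.obj A)) ≫ T.μ.app (S.obj (S.obj A)) ≫ T.map (S.μ.app A)) ≫
      T.map α ≫ β = T.map (S.map (T.map α ≫ β)) ≫ T.map α ≫ β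
    simp only [Functor.map_comp, Category.assoc]
    -- The inner `β` is carried past the outer `α` by `h`, and naturality of the law does the same
    -- for the inner `α`; the repeated actions then collapse by `hα'` and `hβ'`.
    rw [← T.map_comp_assoc (S.μ.app A), hα', ← T.map_comp_assoc (S.map β), h,
      ← T.map_comp_assoc (S.map (T.map α)), reassoc_of% h1, T.map_comp_assoc (S.map α)]
    simp only [Functor.map_comp, Category.assoc]
    rw [← hβ', reassoc_of% h3, reassoc_of% h2]

variable {α β} (hα : S.η.app A ≫ α = 𝟙 A) (hα' : S.μ.app A ≫ α = S.map α ≫ α)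
    (hβ : T.η.app A ≫ β = 𝟙 A) (hβ' : T.μ.app A ≫ β = T.map β ≫ β)
    (h : S.map β ≫ α = d.law.app A ≫ T.map α ≫ β)

theorem actLeft_algebraMk : d.actLeft (d.algebraMk α β hα hα' hβ hβ' h) = α := by
  have h1 := T.η.naturality α
  dsimp at h1
  change T.η.app (S.obj A) ≫ T.map α ≫ β = α
  rw [← reassoc_of% h1, hβ, Category.comp_id]

theorem actRight_algebraMk : d.actRight (d.algebraMk α β hα hα' hβ hβ' h) = β := by
  change T.map (S.η.app A) ≫ T.map α ≫ β = β
  rw [← T.map_comp_assoc, hα]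
  exact (congrArg (· ≫ β) (T.map_id A)).trans (Category.id_comp β)

end Assemble

end DistributiveLaw

/-! ### Morphisms of set operads -/

namespace SetOperad

/-- A morphism of operads in sets. -/
structure Hom {E : Type*} {E' : Type*} (O : SetOperad E) (O' : SetOperad E') where
  toFun : E → E'
  arity_eq : ∀ p : E, O'.arity (toFun p) = O.arity p
  map_one : toFun O.one = O'.one
  map_comp : ∀ p l h, toFun (O.comp p l h) =
    O'.comp (toFun p) (l.map toFun) (by rw [List.length_map, arity_eq, h])

namespace Hom

variable {E E' E'' : Type*} {O : SetOperad E} {O' : SetOperad E'} {O'' : SetOperad E''}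

/-- The identity morphism of operads. -/
def id (O : SetOperad E) : O.Hom O where
  toFun p := p
  arity_eq _ := rfl
  map_one := rfl
  map_comp _ l h := O.comp_congr rfl (List.map_id l).symm h

/-- Composition of morphisms of operads. -/
def comp (φ : O.Hom O') (ψ : O'.Hom O'') : O.Hom O'' where
  toFun p := ψ.toFun (φ.toFun p)
  arity_eq p := (ψ.arity_eq _).trans (φ.arity_eq p)
  map_one := (congrArg ψ.toFun φ.map_one).trans ψ.map_one
  map_comp p l h := by
    rw [φ.map_comp, ψ.map_comp]
    exact O''.comp_congr rfl (by rw [List.map_map]; rfl) _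

/-- A left inverse of an injective morphism of operads is a morphism of operads. -/
def ofInverse (φ : O.Hom O') (f : E' → E) (hf : ∀ p, f (φ.toFun p) = p)
    (hf' : ∀ q, φ.toFun (f q) = q) : O'.Hom O where
  toFun := f
  arity_eq q := by rw [← φ.arity_eq, hf']
  map_one := by rw [← φ.map_one, hf]
  map_comp q l h := by
    rw [← hf (O.comp _ _ _), φ.map_comp]
    refine congrArg f (O'.comp_congr (hf' q).symm ?_ _)
    rw [List.map_map]
    exact ((List.map_congr_left (fun x _ => hf' x)).trans (List.map_id l)).symm

end Hom

/-! ### Functoriality of operadic strings -/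

namespace Free

variable {E E' E'' : Type*} {O : SetOperad E} {O' : SetOperad E'} {O'' : SetOperad E''}
  {S S' S'' : Type*} {H : S → S → Type*} {H' : S' → S' → Type*} {H'' : S'' → S'' → Type*}

/-- The map of free operadic strings induced by a morphism of operads and a map of graphs. -/
def mapHom (φ : O.Hom O') (g : S → S') (F : ∀ a b, H a b → H' (g a) (g b)) {a b : S}
    (x : O.Free H a b) : O'.Free H' (g a) (g b) :=
  x.map φ.toFun φ.arity_eq g F

theorem mapHom_pure (φ : O.Hom O') (g : S → S') (F : ∀ a b, H a b → H' (g a) (g b)) {a b : S}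
    (f : H a b) : (pure O f).mapHom φ g F = pure O' (F _ _ f) :=
  map_pure _ _ φ.map_one _ _ _

theorem mapHom_join (φ : O.Hom O') (g : S → S') (F : ∀ a b, H a b → H' (g a) (g b)) {a b : S}
    (x : O.Free (fun a b => O.Free H a b) a b) :
    x.join.mapHom φ g F =
      (x.mapHom (H' := fun a b => O'.Free H' a b) φ g (fun _ _ y => y.mapHom φ g F)).join :=
  map_join _ _ φ.map_comp _ _ _

/-- Most identities between cells below are proved by fusing each side into one `mapHom` with this
lemma and then comparing operations and arrows separately with `mapHom_congr`. -/
theorem mapHom_mapHom (φ : O.Hom O') (ψ : O'.Hom O'') (g : S → S')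
    (F : ∀ a b, H a b → H' (g a) (g b)) (g' : S' → S'')
    (F' : ∀ a b, H' a b → H'' (g' a) (g' b)) {a b : S} (x : O.Free H a b) :
    (x.mapHom φ g F).mapHom ψ g' F' =
      x.mapHom (φ.comp ψ) (fun a => g' (g a)) (fun _ _ f => F' _ _ (F _ _ f)) :=
  map_map _ _ _ _ _ _ _ _ _

theorem mapHom_congr {φ ψ : O.Hom O'} (h : ∀ p, φ.toFun p = ψ.toFun p) {g : S → S'}
    {F F' : ∀ a b, H a b → H' (g a) (g b)} (hF : ∀ a b f, F a b f = F' a b f) {a b : S}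
    (x : O.Free H a b) : x.mapHom φ g F = x.mapHom ψ g F' := by
  have : F = F' := by
    funext a b f
    exact hF a b f
  subst this
  exact Free.ext (h _) rfl

theorem mapHom_id {a b : S} (x : O.Free H a b) :
    x.mapHom (Hom.id O) (fun a => a) (fun _ _ f => f) = x :=
  map_id x

theorem mapHom_eq_self {φ : O.Hom O} (h : ∀ p, φ.toFun p = p)
    {F : ∀ a b, H a b → H a b} (hF : ∀ a b f, F a b f = f) {a b : S}
    (x : O.Free H a b) : x.mapHom φ (fun a => a) F = x :=
  (mapHom_congr (ψ := Hom.id O) h hF x).trans x.mapHom_id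

end Free

end SetOperad

/-! ### Strings of generalised elements -/

section Cells

variable {V : Type u} [Category.{v} V] [HasFiniteProducts V]

namespace VGraph

/-- The two shapes agree only propositionally, so the two tuples live in different hom-sets. Pairing
a shape with its morphism in a `Σ`-type lets the induction rebuild the outer factor by `congrArg`,
without casts. -/
theorem tuple_map_comp (A : VGraph.{w} V) {X Y : V} (u : X ⟶ Y) {a b : A.obj}
    (z : Str (fun a b : A.obj => Y ⟶ A.hom a b) a b) :
    (⟨shape (z.map (H' := fun a b : A.obj => X ⟶ A.hom a b) (fun a => a) (fun _ _ f => u ≫ f)),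
        A.tuple (z.map (H' := fun a b : A.obj => X ⟶ A.hom a b) (fun a => a)
          (fun _ _ f => u ≫ f))⟩ :
      Σ t : Str (fun _ _ : A.obj => PUnit.{1}) a b, X ⟶ A.prodHom t) =
    ⟨shape z, u ≫ A.tuple z⟩ := by
  induction z with
  | nil => exact congrArg (Sigma.mk _) (Subsingleton.elim (α := X ⟶ ⊤_ V) _ _)
  | @cons b c f z ih =>
    have := congrArg (fun t : Σ t : Str (fun _ _ : A.obj => PUnit.{1}) a b, X ⟶ A.prodHom t =>
      (⟨Str.cons (c := c) PUnit.unit t.1, prod.lift (u ≫ f) t.2⟩ :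
        Σ t : Str (fun _ _ : A.obj => PUnit.{1}) a c, X ⟶ A.prodHom t)) ih
    exact this.trans (congrArg (Sigma.mk _) (prod.comp_lift _ _ _).symm)

theorem tuple_map_hom {A B : VGraph.{w} V} (F : A ⟶ B) {X : V} {a b : A.obj}
    (z : Str (fun a b : A.obj => X ⟶ A.hom a b) a b) :
    (⟨shape (z.map (H' := fun a b : B.obj => X ⟶ B.hom a b) F.obj
          (fun a b f => f ≫ F.hom a b)),
        B.tuple (z.map (H' := fun a b : B.obj => X ⟶ B.hom a b) F.obj
          (fun a b f => f ≫ F.hom a b))⟩ :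
      Σ t : Str (fun _ _ : B.obj => PUnit.{1}) (F.obj a) (F.obj b), X ⟶ B.prodHom t) =
    ⟨(shape z).map F.obj (fun _ _ x => x), A.tuple z ≫ prodHomMap F (shape z)⟩ := by
  induction z with
  | nil => exact congrArg (Sigma.mk _) (Subsingleton.elim (α := X ⟶ ⊤_ V) _ _)
  | @cons b c f z ih =>
    have := congrArg (fun t : Σ t : Str (fun _ _ : B.obj => PUnit.{1}) (F.obj a) (F.obj b),
        X ⟶ B.prodHom t =>
      (⟨Str.cons (c := F.obj c) PUnit.unit t.1, prod.lift (f ≫ F.hom b c) t.2⟩ :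
        Σ t : Str (fun _ _ : B.obj => PUnit.{1}) (F.obj a) (F.obj c), X ⟶ B.prodHom t)) ih
    exact this.trans (congrArg (Sigma.mk _) (prod.lift_map _ _ _ _).symm)

/-- The string of projections of a product of hom-objects. -/
noncomputable def projStr (A : VGraph.{w} V) {a : A.obj} :
    ∀ {b : A.obj} (s : Str (fun _ _ : A.obj => PUnit.{1}) a b),
      Str (fun a b : A.obj => A.prodHom s ⟶ A.hom a b) a b
  | _, Str.nil => Str.nil
  | _, Str.cons (b := b) (c := c) _ s =>
    Str.cons (prod.fst : A.hom b c ⨯ A.prodHom s ⟶ A.hom b c)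
      ((projStr A s).map (fun a => a) (fun _ _ f => (prod.snd : A.hom b c ⨯ A.prodHom s ⟶ _) ≫ f))

theorem tuple_projStr (A : VGraph.{w} V) {a b : A.obj}
    (s : Str (fun _ _ : A.obj => PUnit.{1}) a b) :
    (⟨shape (A.projStr s), A.tuple (A.projStr s)⟩ :
      Σ t : Str (fun _ _ : A.obj => PUnit.{1}) a b, A.prodHom s ⟶ A.prodHom t) = ⟨s, 𝟙 _⟩ := by
  induction s with
  | nil => exact congrArg (Sigma.mk _) (Subsingleton.elim (α := _ ⟶ ⊤_ V) _ _)
  | @cons b c f s ih =>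
    have h := A.tuple_map_comp (prod.snd : A.hom b c ⨯ A.prodHom s ⟶ _) (A.projStr s)
    have h' := congrArg (fun t : Σ t : Str (fun _ _ : A.obj => PUnit.{1}) a b,
        A.prodHom s ⟶ A.prodHom t =>
      (⟨t.1, (prod.snd : A.hom b c ⨯ A.prodHom s ⟶ _) ≫ t.2⟩ :
        Σ t : Str (fun _ _ : A.obj => PUnit.{1}) a b,
          A.hom b c ⨯ A.prodHom s ⟶ A.prodHom t)) ih
    have := congrArg (fun t : Σ t : Str (fun _ _ : A.obj => PUnit.{1}) a b,
        A.hom b c ⨯ A.prodHom s ⟶ A.prodHom t =>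
      (⟨Str.cons (c := c) PUnit.unit t.1, prod.lift prod.fst t.2⟩ :
        Σ t : Str (fun _ _ : A.obj => PUnit.{1}) a c,
          A.hom b c ⨯ A.prodHom s ⟶ A.prodHom t)) (h.trans h')
    refine this.trans (congrArg (Sigma.mk _) ?_)
    dsimp only
    rw [Category.comp_id]
    exact prod.lift_fst_snd

/-- Together with `tuple_projStr`, this is the universal property of the iterated product in terms
of strings: tupling and composing with the projections are mutually inverse. -/
theorem projStr_map_tuple (A : VGraph.{w} V) {X : V} {a b : A.obj}
    (z : Str (fun a b : A.obj => X ⟶ A.hom a b) a b) :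
    (A.projStr (shape z)).map (H' := fun a b : A.obj => X ⟶ A.hom a b) (fun a => a)
      (fun _ _ f => A.tuple z ≫ f) = z := by
  induction z with
  | nil => rfl
  | @cons b c f z ih =>
    have h1 : prod.lift f (A.tuple z) ≫ prod.fst = f := prod.lift_fst _ _
    have h2 : ((A.projStr (shape z)).map (H' := fun a' b' : A.obj =>
        A.hom b c ⨯ A.prodHom (shape z) ⟶ A.hom a' b') (fun a => a)
        (fun _ _ f => prod.snd ≫ f)).map (H' := fun a b : A.obj => X ⟶ A.hom a b) (fun a => a)
        (fun _ _ g => prod.lift f (A.tuple z) ≫ g) = z := by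
      rw [Str.map_map]
      refine Eq.trans ?_ ih
      congr 1
      funext a' b' g
      exact prod.lift_snd_assoc _ _ _
    exact congrArg₂ (Str.cons (H := fun a b : A.obj => X ⟶ A.hom a b)) h1 h2

end VGraph

namespace Operad

variable (P : Operad V)

/-- Restriction of generalised elements, as a morphism of operads. -/
noncomputable def elMapHom {X Y : V} (u : X ⟶ Y) : (P.stage Y).Hom (P.stage X) where
  toFun := P.elMap u
  arity_eq _ := rfl
  map_one := P.elMap_one u
  map_comp := P.elMap_comp u

/-- Strings of generalised elements, at stage `X`, of the hom-objects of `A`, together with a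
generalised element of `P`. -/
abbrev Cells (A : VGraph.{w} V) (X : V) (a b : A.obj) :=
  (P.stage X).Free (fun a b : A.obj => X ⟶ A.hom a b) a b

variable {P} {A B : VGraph.{w} V} {X Y : V} {a b : A.obj}

/-- Restriction of strings of generalised elements. -/
noncomputable def Cells.restrict (u : X ⟶ Y) (x : P.Cells A Y a b) : P.Cells A X a b :=
  x.mapHom (P.elMapHom u) (fun a => a) (fun _ _ f => u ≫ f)

/-- The action of a morphism of graphs on strings of generalised elements. -/
noncomputable def Cells.mapGraph (F : A ⟶ B) (x : P.Cells A X a b) : P.Cells B X (F.obj a) (F.obj b) :=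
  x.mapHom (H' := fun a b : B.obj => X ⟶ B.hom a b) (SetOperad.Hom.id _) F.obj
    (fun a b f => f ≫ F.hom a b)

variable (P)

/-- The universal string of generalised elements of a given shape. -/
noncomputable def univCell (A : VGraph.{w} V) {a b : A.obj} (k : ℕ)
    (s : Str (fun _ _ : A.obj => PUnit.{1}) a b) (h : s.length = k) :
    P.Cells A (P.obj k ⨯ A.prodHom s) a b where
  op := ⟨k, prod.fst⟩
  str := (A.projStr s).map (fun a => a) (fun _ _ f => prod.snd ≫ f)
  length_eq := by
    have e : VGraph.shape (A.projStr s) = s := congrArg Sigma.fst (A.tuple_projStr s)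
    rw [Str.length_map]
    refine Eq.trans ?_ h
    conv_rhs => rw [← e]
    rw [VGraph.shape, Str.length_map]

theorem tuple_univCell (A : VGraph.{w} V) {a b : A.obj} (k : ℕ)
    (s : Str (fun _ _ : A.obj => PUnit.{1}) a b) (h : s.length = k) :
    (⟨VGraph.shape (P.univCell A k s h).str, A.tuple (P.univCell A k s h).str⟩ :
      Σ t : Str (fun _ _ : A.obj => PUnit.{1}) a b, P.obj k ⨯ A.prodHom s ⟶ A.prodHom t) =
    ⟨s, prod.snd⟩ := by
  refine ((A.tuple_map_comp (prod.snd : P.obj k ⨯ A.prodHom s ⟶ _) (A.projStr s)).trans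
    (congrArg (fun t : Σ t : Str (fun _ _ : A.obj => PUnit.{1}) a b,
        A.prodHom s ⟶ A.prodHom t =>
      (⟨t.1, (prod.snd : P.obj k ⨯ A.prodHom s ⟶ _) ≫ t.2⟩ :
        Σ t : Str (fun _ _ : A.obj => PUnit.{1}) a b,
          P.obj k ⨯ A.prodHom s ⟶ A.prodHom t)) (A.tuple_projStr s))).trans ?_
  exact congrArg (Sigma.mk s) (Category.comp_id _)

variable {P}

/-- The Yoneda principle for cells: each cell is pulled back from the universal cell of its shape. A
natural operation on cells is therefore determined by its values on universal cells, that is, by a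
family of composition morphisms. -/
theorem restrict_univCell (x : P.Cells A X a b) :
    (P.univCell A x.op.arity (VGraph.shape x.str)
      (by rw [VGraph.shape, Str.length_map]; exact x.length_eq)).restrict
      (prod.lift x.op.hom (A.tuple x.str)) = x := by
  refine SetOperad.Free.ext ?_ ?_
  · exact congrArg (OperadData.El.mk x.op.arity) (prod.lift_fst _ _)
  · refine Eq.trans ?_ (A.projStr_map_tuple x.str)
    refine (Str.map_map _ _ _ _ _).trans ?_
    congr 1
    funext a' b' f
    exact prod.lift_snd_assoc _ _ _

end Operad

/-! ### Categories weakened by an operad, via their action on generalised elements -/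

namespace PCategoryData

variable {P : Operad V} (A : PCategoryData.{w} P)

/-- Transport along an equality of shapes: `A.comp` depends on the shape and on a proof about its
length, so shape and tuple have to be replaced simultaneously. -/
theorem act_eq_of_sigma {X : V} {a b : A.obj} {k : ℕ} (p : X ⟶ P.obj k)
    {t t' : Σ t : Str (fun _ _ : A.obj => PUnit.{1}) a b, X ⟶ A.prodHom t} (e : t = t')
    (h : t.1.length = k) (h' : t'.1.length = k) :
    prod.lift p t.2 ≫ A.comp k t.1 h = prod.lift p t'.2 ≫ A.comp k t'.1 h' := by
  subst e
  rfl

theorem act_restrict {X Y : V} (u : X ⟶ Y) {a b : A.obj} (x : P.Cells A.toVGraph Y a b) :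
    A.act (x.restrict u) = u ≫ A.act x := by
  have hl : (VGraph.shape x.str).length = x.op.arity := by
    rw [VGraph.shape, Str.length_map]
    exact x.length_eq
  refine (A.act_eq_of_sigma (u ≫ x.op.hom) (A.tuple_map_comp u x.str) _ hl).trans ?_
  rw [← prod.comp_lift, Category.assoc]
  rfl

theorem act_univCell {a b : A.obj} (k : ℕ) (s : Str (fun _ _ : A.obj => PUnit.{1}) a b)
    (h : s.length = k) : A.act (P.univCell A.toVGraph k s h) = A.comp k s h := by
  refine (A.act_eq_of_sigma (prod.fst : P.obj k ⨯ A.prodHom s ⟶ _)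
    (P.tuple_univCell A.toVGraph k s h) _ h).trans ?_
  rw [prod.lift_fst_snd, Category.id_comp]

/-- Composition morphisms obtained from an action on generalised elements. -/
noncomputable def ofAct (G : VGraph.{w} V)
    (φ : ∀ {X : V} {a b : G.obj}, P.Cells G X a b → (X ⟶ G.hom a b)) : PCategoryData.{w} P where
  toVGraph := G
  comp k _ _ s h := φ (P.univCell G k s h)

theorem ofAct_congr {G : VGraph.{w} V}
    {φ φ' : ∀ {X : V} {a b : G.obj}, P.Cells G X a b → (X ⟶ G.hom a b)}
    (h : ∀ {X : V} {a b : G.obj} (x : P.Cells G X a b), φ x = φ' x) : ofAct G φ = ofAct G φ' := by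
  refine congrArg (PCategoryData.mk G) ?_
  funext k a b s hs
  exact h _

/-- With `ofAct_act`, this identifies composition morphisms with natural actions on cells, so that a
weakened category can be built and compared entirely on generalised elements. -/
theorem act_ofAct (G : VGraph.{w} V)
    (φ : ∀ {X : V} {a b : G.obj}, P.Cells G X a b → (X ⟶ G.hom a b))
    (hφ : ∀ {X Y : V} (u : X ⟶ Y) {a b : G.obj} (x : P.Cells G Y a b),
      φ (x.restrict u) = u ≫ φ x) {X : V} {a b : G.obj} (x : P.Cells G X a b) :
    (ofAct G φ).act x = φ x :=
  (hφ _ _).symm.trans (congrArg φ (Operad.restrict_univCell x))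

theorem ofAct_act : ofAct A.toVGraph A.act = A := by
  obtain ⟨G, c⟩ := A
  refine congrArg (PCategoryData.mk G) ?_
  funext k a b s h
  exact act_univCell ⟨G, c⟩ k s h

end PCategoryData

namespace PCategory

variable {P : Operad V}

/-- A `(V, P)`-category, from a natural action on generalised elements. -/
noncomputable def ofAct (G : VGraph.{w} V)
    (φ : ∀ {X : V} {a b : G.obj}, P.Cells G X a b → (X ⟶ G.hom a b))
    (hφ : ∀ {X Y : V} (u : X ⟶ Y) {a b : G.obj} (x : P.Cells G Y a b),
      φ (x.restrict u) = u ≫ φ x)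
    (pure : ∀ {X : V} {a b : G.obj} (f : X ⟶ G.hom a b),
      φ (SetOperad.Free.pure (P.stage X) f) = f)
    (join : ∀ {X : V} {a b : G.obj}
      (x : (P.stage X).Free (fun a b => P.Cells G X a b) a b),
      φ x.join = φ (x.mapHom (SetOperad.Hom.id _) (fun a => a) (fun _ _ y => φ y))) :
    PCategory.{w} P where
  toPCategoryData := PCategoryData.ofAct G φ
  act_pure f := (PCategoryData.act_ofAct G φ hφ _).trans (pure f)
  act_join {X a b} x := by
    refine (PCategoryData.act_ofAct G φ hφ _).trans ?_
    refine (join x).trans ((PCategoryData.act_ofAct G φ hφ _).trans (congrArg φ ?_)).symm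
    exact SetOperad.Free.mapHom_congr (φ := SetOperad.Hom.id _)
      (ψ := SetOperad.Hom.id _) (H := fun a b : G.obj => P.Cells G X a b)
      (H' := fun a b : G.obj => X ⟶ G.hom a b) (g := fun a => a)
      (F := fun _ _ y => (PCategoryData.ofAct G φ).act y) (F' := fun _ _ y => φ y) (fun _ => rfl)
      (fun a b y => PCategoryData.act_ofAct G φ hφ y) x

theorem ext_data {A B : PCategory.{w} P} (h : A.toPCategoryData = B.toPCategoryData) : A = B := by
  cases A
  cases B
  cases h
  rfl

/-- The same axiom phrased with `mapHom`, so that the fusion lemmas apply to it. -/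
theorem act_join' (A : PCategory.{w} P) {X : V} {a b : A.obj}
    (x : (P.stage X).Free (fun a b => P.Cells A.toVGraph X a b) a b) :
    A.act x.join =
      A.act (x.mapHom (SetOperad.Hom.id _) (fun a => a) (fun _ _ y => A.act y)) :=
  A.act_join x

theorem act_mapGraph {A B : PCategoryData.{w} P} (F : A.toVGraph ⟶ B.toVGraph) {X : V}
    {a b : A.obj} (x : P.Cells A.toVGraph X a b) :
    B.act (x.mapGraph F) = prod.lift x.op.hom (A.tuple x.str) ≫
      prod.map (𝟙 _) (VGraph.prodHomMap F (VGraph.shape x.str)) ≫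
        B.comp x.op.arity ((VGraph.shape x.str).map F.obj (fun _ _ x => x))
          (by rw [Str.length_map, VGraph.shape, Str.length_map]; exact x.length_eq) := by
  refine (B.act_eq_of_sigma x.op.hom (VGraph.tuple_map_hom F x.str) _
    (by rw [Str.length_map, VGraph.shape, Str.length_map]; exact x.length_eq)).trans ?_
  rw [prod.lift_map_assoc, Category.comp_id]

theorem Hom.comm_act {A B : PCategory.{w} P} (F : Hom A B) {X : V} {a b : A.obj}
    (x : P.Cells A.toVGraph X a b) :
    A.act x ≫ F.graph.hom a b = B.act (x.mapGraph F.graph) := by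
  rw [act_mapGraph, ← F.comm]
  exact Category.assoc _ _ _

/-- A morphism of graphs commuting with the actions on generalised elements is a morphism of
`(V, P)`-categories. -/
def Hom.ofAct {A B : PCategory.{w} P} (F : A.toVGraph ⟶ B.toVGraph)
    (hF : ∀ {X : V} {a b : A.obj} (x : P.Cells A.toVGraph X a b),
      A.act x ≫ F.hom a b = B.act (x.mapGraph F)) : Hom A B where
  graph := F
  comm k a b s h := by
    -- The universal cell is enough: the action of `A` on it is the composition morphism itself.
    have e := hF (P.univCell A.toVGraph k s h)
    rw [A.act_univCell] at e
    have key : ∀ {t t' : Σ t : Str (fun _ _ : A.obj => PUnit.{1}) a b,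
          P.obj k ⨯ A.prodHom s ⟶ A.prodHom t} (_ : t = t') (h : t.1.length = k)
        (h' : t'.1.length = k),
        prod.lift (prod.fst : _ ⟶ P.obj k) t.2 ≫ prod.map (𝟙 _) (VGraph.prodHomMap F t.1) ≫
          B.comp k (t.1.map F.obj (fun _ _ x => x)) (by rw [Str.length_map, h]) =
        prod.lift (prod.fst : _ ⟶ P.obj k) t'.2 ≫ prod.map (𝟙 _) (VGraph.prodHomMap F t'.1) ≫
          B.comp k (t'.1.map F.obj (fun _ _ x => x)) (by rw [Str.length_map, h']) := by
      rintro t _ rfl h h'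
      rfl
    have hl : (VGraph.shape (P.univCell A.toVGraph k s h).str).length = k := by
      rw [VGraph.shape, Str.length_map]
      exact (P.univCell A.toVGraph k s h).length_eq
    refine e.trans ((act_mapGraph F _).trans
      ((key (P.tuple_univCell A.toVGraph k s h) hl h).trans ?_))
    rw [prod.lift_fst_snd, Category.id_comp]

end PCategory

end Cells

/-! ### Generalised elements of the free category on a graph of presheaves -/

section Presheaves

variable {C : Type w} [SmallCategory C]

namespace Operad

section

variable (P : Operad (Cᵒᵖ ⥤ Type w))

/-- Generalised elements at a representable stage are sections. -/
noncomputable def toSecHom (c : Cᵒᵖ) : (P.stage (yoneda.obj c.unop)).Hom (P.sec c) where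
  toFun := P.toSec
  arity_eq _ := rfl
  map_one := rfl
  map_comp p l h := by
    refine congrArg P.toSec ((P.stage (yoneda.obj c.unop)).comp_congr (P.ofSec_toSec p).symm ?_ h)
    rw [List.map_map]
    exact ((List.map_congr_left (fun x _ => P.ofSec_toSec x)).trans (List.map_id l)).symm

/-- By the Yoneda lemma, restricting along the morphism from a representable named by `ξ` amounts to
evaluating at `ξ`. -/
theorem toSec_elMap_yonedaEquiv {X : Cᵒᵖ ⥤ Type w} {c : Cᵒᵖ} (ξ : X.obj c) (p : P.El X) :
    P.toSec (P.elMap (X := yoneda.obj c.unop) (yonedaEquiv.symm ξ) p) =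
      ⟨p.arity, p.hom.app c ξ⟩ := by
  refine congrArg (Sec.mk p.arity) ?_
  exact (yonedaEquiv_comp _ _).trans (congrArg _ (Equiv.apply_symm_apply _ _))

/-- Evaluation of generalised elements of an operad at a section of the stage. -/
noncomputable def evalHom {X : Cᵒᵖ ⥤ Type w} {c : Cᵒᵖ} (ξ : X.obj c) :
    (P.stage X).Hom (P.sec c) where
  toFun p := ⟨p.arity, p.hom.app c ξ⟩
  arity_eq _ := rfl
  map_one := by
    -- Evaluation at `ξ` factors as restriction to a representable stage followed by the Yoneda
    -- bijection, and both are already morphisms of operads.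
    rw [← toSec_elMap_yonedaEquiv]
    exact ((P.elMapHom (yonedaEquiv.symm ξ)).comp (P.toSecHom c)).map_one
  map_comp p l h := by
    rw [← toSec_elMap_yonedaEquiv]
    refine (((P.elMapHom (yonedaEquiv.symm ξ)).comp (P.toSecHom c)).map_comp p l h).trans ?_
    refine (P.sec c).comp_congr (P.toSec_elMap_yonedaEquiv ξ p) ?_ _
    exact List.map_congr_left (fun x _ => P.toSec_elMap_yonedaEquiv ξ x)

/-- Restriction of sections, as a morphism of operads. -/
noncomputable def secMapHom {c c' : Cᵒᵖ} (f : c ⟶ c') : (P.sec c).Hom (P.sec c') where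
  toFun := P.secMap f
  arity_eq _ := rfl
  map_one := P.secMap_one f
  map_comp := P.secMap_comp f

/-- The graph underlying the free category on a graph. -/
noncomputable abbrev fcGraph (A : VGraph.{w} (Cᵒᵖ ⥤ Type w)) : VGraph.{w} (Cᵒᵖ ⥤ Type w) :=
  ⟨A.obj, P.fcHom A⟩

/-- The action of a morphism of graphs on the hom-objects of free categories. -/
noncomputable def fcMap {A B : VGraph.{w} (Cᵒᵖ ⥤ Type w)} (F : A ⟶ B) (a b : A.obj) :
    P.fcHom A a b ⟶ P.fcHom B (F.obj a) (F.obj b) := (P.fc.map F).hom a b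

/-- The inclusion of generators in the free category. -/
noncomputable def fcUnit (A : VGraph.{w} (Cᵒᵖ ⥤ Type w)) (a b : A.obj) :
    A.hom a b ⟶ P.fcHom A a b := (P.fc.η.app A).hom a b

/-- Composition in the free category. -/
noncomputable def fcMul (A : VGraph.{w} (Cᵒᵖ ⥤ Type w)) (a b : A.obj) :
    P.fcHom (P.fcGraph A) a b ⟶ P.fcHom A a b := (P.fc.μ.app A).hom a b

end

variable {P : Operad (Cᵒᵖ ⥤ Type w)} {A B : VGraph.{w} (Cᵒᵖ ⥤ Type w)} {X Y : Cᵒᵖ ⥤ Type w}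
  {a b : A.obj}

/-- Evaluation of a string of generalised elements at a section of the stage. -/
noncomputable def Cells.eval (x : P.Cells A X a b) {c : Cᵒᵖ} (ξ : X.obj c) :
    (P.fcHom A a b).obj c :=
  x.mapHom (P.evalHom ξ) (fun a => a) (fun _ _ f => f.app c ξ)

/-- The generalised element of the free category given by a string of generalised elements. -/
noncomputable def Cells.emb (x : P.Cells A X a b) : X ⟶ P.fcHom A a b where
  app c := ↾(fun ξ => x.eval ξ)
  naturality := by
    intro c c' f
    apply ConcreteCategory.hom_ext
    intro ξ
    change x.mapHom (P.evalHom (X.map f ξ)) (fun a => a) (fun a' b' g => g.app c' (X.map f ξ)) =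
      (x.eval ξ).mapHom (P.secMapHom f) (fun a => a) (fun a b => (A.hom a b).map f)
    rw [Cells.eval, SetOperad.Free.mapHom_mapHom]
    refine SetOperad.Free.mapHom_congr ?_ ?_ x
    · intro p
      exact congrArg (Sec.mk p.arity) (NatTrans.naturality_apply p.hom f ξ)
    · intro a b g
      exact NatTrans.naturality_apply g f ξ

theorem Cells.emb_app (x : P.Cells A X a b) {c : Cᵒᵖ} (ξ : X.obj c) :
  x.emb.app c ξ = x.eval ξ := rfl

theorem hom_ext_app {F G : Cᵒᵖ ⥤ Type w} {f g : F ⟶ G} (h : ∀ c (ξ : F.obj c), f.app c ξ = g.app c ξ) :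
    f = g := by
  apply NatTrans.ext
  funext c
  apply ConcreteCategory.hom_ext
  exact h c

theorem Cells.emb_restrict (u : X ⟶ Y) (x : P.Cells A Y a b) : (x.restrict u).emb = u ≫ x.emb := by
  apply hom_ext_app
  intro c ξ
  refine (SetOperad.Free.mapHom_mapHom _ _ _ _ _ _ x).trans ?_
  exact SetOperad.Free.mapHom_congr (φ := (P.elMapHom u).comp (P.evalHom ξ)) (ψ := P.evalHom (u.app c ξ)) (H := fun a b : A.obj => Y ⟶ A.hom a b) (H' := fun a b : A.obj => (A.hom a b).obj c) (g := fun a => a)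
    (F := fun _ _ f => (u ≫ f).app c ξ) (F' := fun _ _ f => f.app c (u.app c ξ))
    (fun p => rfl) (fun _ _ _ => rfl) x

theorem Cells.emb_mapGraph (F : A ⟶ B) (x : P.Cells A X a b) :
    (x.mapGraph F).emb = x.emb ≫ P.fcMap F a b := by
  apply hom_ext_app
  intro c ξ
  change (x.mapGraph F).eval ξ =
    (x.eval ξ).mapHom (SetOperad.Hom.id _) F.obj (fun a b => (F.hom a b).app c)
  rw [Cells.eval, Cells.mapGraph, Cells.eval, SetOperad.Free.mapHom_mapHom,
    SetOperad.Free.mapHom_mapHom]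
  exact SetOperad.Free.mapHom_congr (fun _ => rfl) (fun _ _ _ => rfl) x

theorem emb_pure (f : X ⟶ A.hom a b) :
    Cells.emb (P := P) (SetOperad.Free.pure (P.stage X) f) = f ≫ P.fcUnit A a b := by
  apply hom_ext_app
  intro c ξ
  exact SetOperad.Free.mapHom_pure (P.evalHom ξ) (fun a => a)
    (fun a b (f : X ⟶ A.hom a b) => f.app c ξ) f

/-- The string of generalised elements of a free category given by a string of strings. -/
noncomputable def embCells (x : (P.stage X).Free (fun a b => P.Cells A X a b) a b) :
    P.Cells (P.fcGraph A) X a b :=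
  x.mapHom (H' := fun a b : A.obj => X ⟶ P.fcHom A a b) (SetOperad.Hom.id _) (fun a => a)
    (fun _ _ y => y.emb)

/-- Multiplication in `fc` is `join` on sections, and evaluation at a section is a morphism of
operads, so it commutes with `join`. -/
theorem emb_join (x : (P.stage X).Free (fun a b => P.Cells A X a b) a b) :
    Cells.emb (P := P) x.join = (embCells x).emb ≫ P.fcMul A a b := by
  apply hom_ext_app
  intro c ξ
  refine (SetOperad.Free.mapHom_join (P.evalHom ξ) (fun a => a)
    (fun a b (f : X ⟶ A.hom a b) => f.app c ξ) x).trans ?_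
  change _ = ((embCells x).eval ξ).join
  refine congrArg SetOperad.Free.join ?_
  refine Eq.trans ?_ (SetOperad.Free.mapHom_mapHom (SetOperad.Hom.id _) (P.evalHom ξ)
    (fun a => a) (fun _ _ y => Cells.emb y) (fun a => a) (fun a b f => f.app c ξ) x).symm
  exact SetOperad.Free.mapHom_congr (fun _ => rfl) (fun _ _ _ => rfl) x

end Operad

end Presheaves

/-! ### Presheaves partitioned by a locally constant labelling -/

section Labels

variable {C : Type w} [SmallCategory C]

/-- The part of a presheaf on which a restriction-invariant labelling takes a given value. -/
def labelFibre (Z : Cᵒᵖ ⥤ Type w) {I : Type w} (ℓ : ∀ c, Z.obj c → I)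
    (hℓ : ∀ {c c'} (f : c ⟶ c') z, ℓ c' (Z.map f z) = ℓ c z) (i : I) : Cᵒᵖ ⥤ Type w where
  obj c := {z : Z.obj c // ℓ c z = i}
  map f := ↾(fun z => ⟨Z.map f z.1, (hℓ f z.1).trans z.2⟩)
  map_id c := by
    apply ConcreteCategory.hom_ext
    intro z
    exact Subtype.ext (by simp)
  map_comp f g := by
    apply ConcreteCategory.hom_ext
    intro z
    exact Subtype.ext (by simp)

variable {Z : Cᵒᵖ ⥤ Type w} {I : Type w} {ℓ : ∀ c, Z.obj c → I}
  (hℓ : ∀ {c c'} (f : c ⟶ c') z, ℓ c' (Z.map f z) = ℓ c z)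

/-- The inclusion of a part of a labelled presheaf. -/
def labelFibreι (i : I) : labelFibre Z ℓ hℓ i ⟶ Z where
  app c := ↾(fun z => z.1)

/-- The factorisation of a morphism with constant label through a part of a labelled presheaf. -/
def labelFibreLift {X : Cᵒᵖ ⥤ Type w} (u : X ⟶ Z) (i : I) (hu : ∀ c ξ, ℓ c (u.app c ξ) = i) :
    X ⟶ labelFibre Z ℓ hℓ i where
  app c := ↾(fun ξ => ⟨u.app c ξ, hu c ξ⟩)
  naturality := by
    intro c c' f
    apply ConcreteCategory.hom_ext
    intro ξ
    apply Subtype.ext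
    exact NatTrans.naturality_apply u f ξ

theorem labelFibreLift_ι {X : Cᵒᵖ ⥤ Type w} (u : X ⟶ Z) (i : I)
    (hu : ∀ c ξ, ℓ c (u.app c ξ) = i) : labelFibreLift hℓ u i hu ≫ labelFibreι hℓ i = u := rfl

/-- A labelled presheaf is the coproduct of its parts. -/
def labelFibreIsColimit : IsColimit (Cofan.mk Z (labelFibreι hℓ)) :=
  Cofan.IsColimit.mk _
    (fun s =>
      { app := fun c => ↾(fun z => (s.inj (ℓ c z)).app c ⟨z, rfl⟩)
        naturality := by
          intro c c' f
          apply ConcreteCategory.hom_ext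
          intro z
          -- The label is generalised to a variable `i`, because the labels of `z` and of its
          -- restriction are equal only propositionally and index different components of `s`.
          have key : ∀ (i : I) (hi : ℓ c z = i),
              (s.inj (ℓ c' (Z.map f z))).app c' ⟨Z.map f z, rfl⟩ =
                s.pt.map f ((s.inj i).app c ⟨z, hi⟩) := by
            intro i hi
            have e : ℓ c' (Z.map f z) = i := (hℓ f z).trans hi
            subst e
            exact NatTrans.naturality_apply (s.inj (ℓ c' (Z.map f z))) f ⟨z, hi⟩
          exact key _ rfl })
    (by
      intro s i
      apply NatTrans.ext
      funext c
      apply ConcreteCategory.hom_ext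
      rintro ⟨z, rfl⟩
      rfl)
    (by
      intro s m hm
      apply NatTrans.ext
      funext c
      apply ConcreteCategory.hom_ext
      intro z
      change m.app c z = (s.inj (ℓ c z)).app c ⟨z, rfl⟩
      rw [← hm]
      rfl)

variable {D : Type u} [Category.{v} D] (G : (Cᵒᵖ ⥤ Type w) ⥤ D)
  [∀ J : Type w, PreservesColimitsOfShape (Discrete J) G]

/-- A coproduct-preserving `G` turns the decomposition of `Z` by labels into a coproduct
decomposition of `G Z`. -/
theorem exists_desc_of_label {Y : D} (φ : ∀ i, G.obj (labelFibre Z ℓ hℓ i) ⟶ Y) :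
    ∃ m : G.obj Z ⟶ Y, ∀ i, G.map (labelFibreι hℓ i) ≫ m = φ i :=
  ⟨Cofan.IsColimit.desc (isColimitCofanMkObjOfIsColimit G _ _ (labelFibreIsColimit hℓ)) φ,
    Cofan.IsColimit.fac (isColimitCofanMkObjOfIsColimit G _ _ (labelFibreIsColimit hℓ)) φ⟩

/-- Morphisms out of `G Z` agree if they agree on the inhabited parts of `Z` with constant
label. -/
theorem hom_ext_of_label (hℓ : ∀ {c c'} (f : c ⟶ c') z, ℓ c' (Z.map f z) = ℓ c z)
    {Y : D} {f g : G.obj Z ⟶ Y}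
    (h : ∀ (X : Cᵒᵖ ⥤ Type w) (u : X ⟶ Z) (c₀ : Cᵒᵖ) (ξ₀ : X.obj c₀),
      (∀ c ξ, ℓ c (u.app c ξ) = ℓ c₀ (u.app c₀ ξ₀)) → G.map u ≫ f = G.map u ≫ g) : f = g := by
  -- Only labels that occur are kept as indices, so every part has a section `ξ₀` from which its
  -- label can be read off.
  let ℓ' : ∀ c, Z.obj c → {i : I // ∃ c z, ℓ c z = i} := fun c z => ⟨ℓ c z, c, z, rfl⟩
  have hℓ' : ∀ {c c'} (f : c ⟶ c') z, ℓ' c' (Z.map f z) = ℓ' c z :=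
    fun f z => Subtype.ext (hℓ f z)
  refine Cofan.IsColimit.hom_ext (isColimitCofanMkObjOfIsColimit G _ _ (labelFibreIsColimit hℓ'))
    _ _ ?_
  rintro ⟨_, c₀, z₀, rfl⟩
  exact h _ (labelFibreι hℓ' _) c₀ ⟨z₀, rfl⟩ (fun c ξ => congrArg Subtype.val ξ.2)

end Labels

/-! ### Decomposition of free categories into coproducts -/

section Decompose

namespace Str

variable {O : Type u} {H : O → O → Type v}

theorem cons_inj {a b c : O} {f f' : H b c} {s s' : Str H a b} (h : cons f s = cons f' s') :
    f = f' ∧ s = s' := by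
  cases h
  exact ⟨rfl, rfl⟩

theorem eq_nil_of_shape {a : O} (y : Str H a a) (h : VGraph.shape y = nil) : y = nil := by
  cases y with
  | nil => rfl
  | cons g y => cases h

/-- A shape records the intermediate objects, so the first arrow and the remaining string come with
exactly the prescribed endpoints. -/
theorem exists_cons_of_shape {a b c : O} (y : Str H a c) {x : PUnit}
    {s : Str (fun _ _ : O => PUnit.{1}) a b} (h : VGraph.shape y = cons x s) :
    ∃ (g : H b c) (z : Str H a b), cons g z = y ∧ VGraph.shape z = s := by
  cases y with
  | nil => cases h
  | cons g z =>
    change cons PUnit.unit (VGraph.shape z) = cons x s at h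
    generalize hq : VGraph.shape z = q at h
    cases h
    exact ⟨g, z, rfl, hq⟩

theorem length_shape {a b : O} (y : Str H a b) : (VGraph.shape y).length = y.length :=
  length_map _ _ y

end Str

variable {C : Type w} [SmallCategory C]

namespace Operad

variable {P : Operad (Cᵒᵖ ⥤ Type w)} {A : VGraph.{w} (Cᵒᵖ ⥤ Type w)} {X : Cᵒᵖ ⥤ Type w}

/-- A natural family of strings of constant shape is a string of generalised elements. -/
theorem exists_str {a b : A.obj} (s : Str (fun _ _ : A.obj => PUnit.{1}) a b)
    (v : ∀ c, X.obj c → Str (fun a b : A.obj => (A.hom a b).obj c) a b)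
    (hv : ∀ {c c'} (f : c ⟶ c') ξ, v c' (X.map f ξ) =
      (v c ξ).map (H' := fun a b : A.obj => (A.hom a b).obj c') (fun a => a)
        (fun a b => (A.hom a b).map f))
    (hs : ∀ c ξ, VGraph.shape (v c ξ) = s) :
    ∃ z : Str (fun a b : A.obj => X ⟶ A.hom a b) a b, VGraph.shape z = s ∧
      ∀ c ξ, z.map (H' := fun a b : A.obj => (A.hom a b).obj c) (fun a => a)
        (fun _ _ f => f.app c ξ) = v c ξ := by
  induction s with
  | nil =>
    exact ⟨Str.nil, rfl, fun c ξ => (Str.eq_nil_of_shape _ (hs c ξ)).symm⟩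
  | @cons b c x s ih =>
    -- The constant shape lets each string be split into first arrow and tail, section by section.
    -- Injectivity of `cons` then splits naturality as well, and the tails are handled by induction.
    choose g y hgy hy using fun d ξ => Str.exists_cons_of_shape (v d ξ) (hs d ξ)
    have nat := fun {d d'} (f : d ⟶ d') (ξ : X.obj d) => Str.cons_inj
      ((hgy d' (X.map f ξ)).trans ((hv f ξ).trans
        (congrArg (Str.map (fun a => a) _) (hgy d ξ).symm)))
    obtain ⟨z, hz, hz'⟩ := ih y (fun f ξ => (nat f ξ).2) hy
    refine ⟨Str.cons { app := fun d => ↾(g d), naturality := ?_ } z, ?_, ?_⟩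
    · intro d d' f
      apply ConcreteCategory.hom_ext
      intro ξ
      exact (nat f ξ).1
    · exact congrArg (Str.cons x) hz
    · intro d ξ
      exact (congrArg (Str.cons (g d ξ)) (hz' d ξ)).trans (hgy d ξ)

/-- Equality of shapes must be assumed separately: if the stage has no sections, the values of the
strings say nothing about the objects they pass through. The same applies to the arities in
`el_ext`. -/
theorem str_ext {a b : A.obj} {z z' : Str (fun a b : A.obj => X ⟶ A.hom a b) a b}
    (hs : VGraph.shape z = VGraph.shape z')
    (h : ∀ c ξ, z.map (H' := fun a b : A.obj => (A.hom a b).obj c) (fun a => a)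
      (fun _ _ f => f.app c ξ) = z'.map (H' := fun a b : A.obj => (A.hom a b).obj c) (fun a => a)
      (fun _ _ f => f.app c ξ)) : z = z' := by
  induction z with
  | nil => exact (Str.eq_nil_of_shape _ hs.symm).symm
  | cons f z ih =>
    obtain ⟨g, z', rfl, hz⟩ := Str.exists_cons_of_shape z' hs.symm
    have h' := fun c ξ => Str.cons_inj (h c ξ)
    rw [ih hz.symm (fun c ξ => (h' c ξ).2), hom_ext_app (fun c ξ => (h' c ξ).1)]

/-- A natural family of operations of constant arity is a generalised element. -/
theorem exists_el (k : ℕ) (v : ∀ c, X.obj c → P.Sec c)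
    (hv : ∀ {c c'} (f : c ⟶ c') ξ, v c' (X.map f ξ) = P.secMap f (v c ξ))
    (hk : ∀ c ξ, (v c ξ).arity = k) :
    ∃ p : P.El X, p.arity = k ∧ ∀ c ξ, (P.evalHom ξ).toFun p = v c ξ := by
  have h : ∀ c ξ, ∃ q : (P.obj k).obj c, (⟨k, q⟩ : P.Sec c) = v c ξ := by
    intro c ξ
    have e := hk c ξ
    -- Once the section is a variable, its arity can be replaced by `k`, which places its value in
    -- `P(k)`.
    generalize v c ξ = y at e
    subst e
    exact ⟨y.val, rfl⟩
  choose q hq using h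
  refine ⟨⟨k, { app := fun c => ↾(q c), naturality := ?_ }⟩, rfl, hq⟩
  intro c c' f
  apply ConcreteCategory.hom_ext
  intro ξ
  have e := (hq c' (X.map f ξ)).trans ((hv f ξ).trans (congrArg (P.secMap f) (hq c ξ).symm))
  exact eq_of_heq (Sec.mk.inj e).2

theorem el_ext {p p' : P.El X} (hk : p.arity = p'.arity)
    (h : ∀ c (ξ : X.obj c), (P.evalHom ξ).toFun p = (P.evalHom ξ).toFun p') : p = p' := by
  obtain ⟨k, p⟩ := p
  obtain ⟨k', p'⟩ := p'
  obtain rfl : k = k' := hk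
  exact congrArg (OperadData.El.mk k) (hom_ext_app fun c ξ => eq_of_heq (Sec.mk.inj (h c ξ)).2)

/-- The sequence of objects underlying a section of a hom-object of a free category. -/
noncomputable def cellShape {a b : A.obj} {c : Cᵒᵖ} (y : (P.fcHom A a b).obj c) :
    Str (fun _ _ : A.obj => PUnit.{1}) a b :=
  VGraph.shape (SetOperad.Free.str (O := P.sec c) (H := fun a b : A.obj => (A.hom a b).obj c) y)

/-- Restriction acts on the operation and the arrows but not on the objects; so the shape is an
admissible label for splitting a free category into parts. -/
theorem cellShape_map {a b : A.obj} {c c' : Cᵒᵖ} (f : c ⟶ c') (y : (P.fcHom A a b).obj c) :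
    cellShape ((P.fcHom A a b).map f y) = cellShape y :=
  Str.map_map _ _ _ _ _

theorem cellShape_emb {a b : A.obj} (x : P.Cells A X a b) {c : Cᵒᵖ} (ξ : X.obj c) :
    cellShape (x.emb.app c ξ) = VGraph.shape x.str :=
  Str.map_map _ _ _ _ _

/-- A constant shape confines `u` to a single summand of the coproduct. That summand is a product,
so `u` is a tuple consisting of one operation and a string of arrows. -/
theorem exists_cells {a b : A.obj} (u : X ⟶ P.fcHom A a b)
    (s : Str (fun _ _ : A.obj => PUnit.{1}) a b) (hs : ∀ c ξ, cellShape (u.app c ξ) = s) :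
    ∃ x : P.Cells A X a b, VGraph.shape x.str = s ∧ x.emb = u := by
  obtain ⟨z, hz, hz'⟩ := exists_str s
    (fun c ξ => SetOperad.Free.str (O := P.sec c) (H := fun a b : A.obj => (A.hom a b).obj c)
      (u.app c ξ))
    (fun f ξ => congrArg SetOperad.Free.str (NatTrans.naturality_apply u f ξ)) hs
  obtain ⟨p, hp, hp'⟩ := exists_el (P := P) s.length
    (fun c ξ => SetOperad.Free.op (O := P.sec c) (H := fun a b : A.obj => (A.hom a b).obj c)
      (u.app c ξ))
    (fun f ξ => congrArg SetOperad.Free.op (NatTrans.naturality_apply u f ξ))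
    (fun c ξ => (SetOperad.Free.length_eq (O := P.sec c)
      (H := fun a b : A.obj => (A.hom a b).obj c) (u.app c ξ)).symm.trans
      ((Str.length_shape _).symm.trans (congrArg Str.length (hs c ξ))))
  refine ⟨⟨p, z, ?_⟩, hz, hom_ext_app fun c ξ => SetOperad.Free.ext (hp' c ξ) (hz' c ξ)⟩
  exact (Str.length_shape z).symm.trans ((congrArg Str.length hz).trans hp.symm)

theorem cells_ext {a b : A.obj} {x x' : P.Cells A X a b} (hs : VGraph.shape x.str = VGraph.shape x'.str)
    (h : x.emb = x'.emb) : x = x' := by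
  have h' : ∀ c (ξ : X.obj c), x.eval ξ = x'.eval ξ := fun c ξ => by
    rw [← Cells.emb_app, h, Cells.emb_app]
  refine SetOperad.Free.ext (el_ext ?_ fun c ξ => congrArg SetOperad.Free.op (h' c ξ))
    (str_ext hs fun c ξ => congrArg SetOperad.Free.str (h' c ξ))
  exact x.length_eq.symm.trans ((Str.length_shape _).symm.trans ((congrArg Str.length hs).trans
    ((Str.length_shape _).trans x'.length_eq)))

/-! ### Morphisms out of the image of a free category -/

variable {D : Type u} [Category.{v} D] (G : (Cᵒᵖ ⥤ Type w) ⥤ D)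
  [∀ J : Type w, PreservesColimitsOfShape (Discrete J) G] {Y : D} {a b : A.obj}

/-- The free category is the coproduct of its parts of constant shape, and the inclusion of each
part is a cell; hence the images of cells under `G` are jointly epic. It is used with the identity,
`T` and `T ∘ T` in the role of `G`. -/
theorem map_fcHom_hom_ext {f g : G.obj (P.fcHom A a b) ⟶ Y}
    (h : ∀ (X : Cᵒᵖ ⥤ Type w) (x : P.Cells A X a b),
      G.map x.emb ≫ f = G.map x.emb ≫ g) : f = g := by
  refine hom_ext_of_label G (ℓ := fun c y => cellShape y) (fun f z => cellShape_map f z) ?_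
  intro X u c₀ ξ₀ hu
  obtain ⟨x, -, rfl⟩ := exists_cells u _ hu
  exact h X x

/-- Morphisms out of the image of a free category under a coproduct-preserving functor are given
by natural operations on strings of generalised elements. -/
theorem exists_map_fcHom_desc (φ : ∀ {X : Cᵒᵖ ⥤ Type w}, P.Cells A X a b → (G.obj X ⟶ Y))
    (hφ : ∀ {X X' : Cᵒᵖ ⥤ Type w} (u : X ⟶ X') (x : P.Cells A X' a b),
      φ (x.restrict u) = G.map u ≫ φ x) :
    ∃ m : G.obj (P.fcHom A a b) ⟶ Y, ∀ {X : Cᵒᵖ ⥤ Type w} (x : P.Cells A X a b),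
      G.map x.emb ≫ m = φ x := by
  have hℓ : ∀ {c c'} (f : c ⟶ c') (z : (P.fcHom A a b).obj c),
    cellShape ((P.fcHom A a b).map f z) = cellShape z := fun f z => cellShape_map f z
  -- `x i` is the cell corresponding to the inclusion of the part of shape `i`; the values of `φ` on
  -- these cells define `m`.
  choose x hx hx' using fun i => exists_cells (labelFibreι hℓ i) i (fun c ξ => ξ.2)
  obtain ⟨m, hm⟩ := exists_desc_of_label hℓ G (fun i => φ (x i))
  refine ⟨m, fun {X} y => ?_⟩
  -- An arbitrary cell `y` factors through the part of its own shape, so it is a restriction of the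
  -- chosen cell there, and naturality of `φ` gives the claim.
  have e := labelFibreLift_ι hℓ y.emb (VGraph.shape y.str) (fun c ξ => cellShape_emb y ξ)
  have e' : (x (VGraph.shape y.str)).restrict (labelFibreLift hℓ y.emb (VGraph.shape y.str)
      (fun c ξ => cellShape_emb y ξ)) = y := by
    refine cells_ext ?_ ?_
    · exact (Str.map_map _ _ _ _ _).trans (hx _)
    · rw [Cells.emb_restrict, hx', e]
  rw [← e, G.map_comp, Category.assoc, hm, ← hφ, e']

/-- The section `ξ₀` names the constant shape of each arrow, and `exists_cells` then applies to the
arrows one at a time. -/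
theorem exists_cellsStr {a b : A.obj} (z : Str (fun a b : A.obj => X ⟶ P.fcHom A a b) a b)
    {c₀ : Cᵒᵖ} (ξ₀ : X.obj c₀)
    (h : ∀ c ξ, z.map (H' := fun a b : A.obj => Str (fun _ _ : A.obj => PUnit.{1}) a b)
        (fun a => a) (fun _ _ u => cellShape (u.app c ξ)) =
      z.map (fun a => a) (fun _ _ u => cellShape (u.app c₀ ξ₀))) :
    ∃ y : Str (fun a b : A.obj => P.Cells A X a b) a b,
      y.map (H' := fun a b : A.obj => X ⟶ P.fcHom A a b) (fun a => a) (fun _ _ x => x.emb) = z := by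
  induction z with
  | nil => exact ⟨Str.nil, rfl⟩
  | cons u z ih =>
    obtain ⟨y, rfl⟩ := ih (fun c ξ => (Str.cons_inj (h c ξ)).2)
    obtain ⟨x, -, rfl⟩ := exists_cells u _ (fun c ξ => (Str.cons_inj (h c ξ)).1)
    exact ⟨Str.cons x y, rfl⟩

/-- A cell over a free category may have arrows whose shape varies with the section, so splitting by
the outer shape is too coarse. The label used here is the whole string of inner shapes; on a part
where it is constant, every arrow is again a cell. -/
theorem map_fcHom_fcHom_hom_ext {f g : G.obj (P.fcHom (P.fcGraph A) a b) ⟶ Y}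
    (h : ∀ (X : Cᵒᵖ ⥤ Type w) (x : (P.stage X).Free (fun a b => P.Cells A X a b) a b),
      G.map (embCells x).emb ≫ f = G.map (embCells x).emb ≫ g) : f = g := by
  refine hom_ext_of_label G (ℓ := fun c y => Str.map
    (H' := fun a b : A.obj => Str (fun _ _ : A.obj => PUnit.{1}) a b) (fun a => a)
    (fun a b y => cellShape (P := P) y) (SetOperad.Free.str (O := P.sec c)
      (H := fun a b : A.obj => (P.fcHom A a b).obj c) y)) ?_ ?_
  · intro c c' f z
    refine (Str.map_map _ _ _ _ _).trans ?_
    congr 1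
    funext a b y
    exact cellShape_map f y
  · intro X u c₀ ξ₀ hu
    obtain ⟨x, -, rfl⟩ := exists_cells u (cellShape (u.app c₀ ξ₀)) (by
      intro c ξ
      -- The outer shape is the shape of the string of inner shapes, so it is constant too.
      have e := congrArg VGraph.shape (hu c ξ)
      exact (Str.map_map _ _ _ _ _).symm.trans (e.trans (Str.map_map _ _ _ _ _)))
    obtain ⟨y, hy⟩ := exists_cellsStr (P := P) (A := A) (a := a) (b := b) x.str ξ₀ (fun c ξ =>
      (Str.map_map _ _ _ _ _).symm.trans ((hu c ξ).trans (Str.map_map _ _ _ _ _)))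
    have hl : y.length = x.op.arity :=
      (Str.length_map _ _ y).symm.trans ((congrArg Str.length hy).trans x.length_eq)
    have hx : embCells ⟨x.op, y, hl⟩ = x :=
      SetOperad.Free.ext rfl hy
    rw [← hx]
    exact h X _

end Operad

end Decompose

/-! ### Operads of algebras and free algebras -/

section FreeAlgebras

variable {V : Type u} [Category.{v} V]

/-- The morphism of algebras out of a free algebra induced by a morphism. -/
def algebraLift (T : Monad V) {X : V} {Z : T.Algebra} (f : X ⟶ Z.A) : T.free.obj X ⟶ Z where
  f := T.map f ≫ Z.a
  h := by
    change T.map (T.map f ≫ Z.a) ≫ Z.a = T.μ.app X ≫ T.map f ≫ Z.a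
    have h := T.μ.naturality f
    dsimp at h
    rw [T.map_comp, Category.assoc, ← Z.assoc, reassoc_of% h]

variable {T : Monad V} {X : V} {Z : T.Algebra}

/-- With `algebraLift_unit`, this is the bijection between morphisms `X ⟶ Z.A` and homomorphisms out
of the free algebra on `X`. -/
theorem unit_algebraLift (f : X ⟶ Z.A) : T.η.app X ≫ (algebraLift T f).f = f := by
  have h := T.η.naturality f
  change T.η.app X ≫ T.map f ≫ Z.a = f
  dsimp at h
  rw [← reassoc_of% h, Z.unit]
  exact Category.comp_id f

theorem algebraLift_unit (g : T.free.obj X ⟶ Z) : algebraLift T (T.η.app X ≫ g.f) = g := by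
  apply Monad.Algebra.Hom.ext
  have h : T.map g.f ≫ Z.a = T.μ.app X ≫ g.f := g.h
  have h' := T.right_unit X
  change T.map (T.η.app X ≫ g.f) ≫ Z.a = g.f
  dsimp at h'
  refine (congrArg (· ≫ Z.a) (T.map_comp (T.η.app X) g.f)).trans ((Category.assoc _ _ _).trans ?_)
  refine (congrArg (T.map (T.η.app X) ≫ ·) h).trans ((Category.assoc _ _ _).symm.trans ?_)
  exact (congrArg (· ≫ g.f) h').trans (Category.id_comp _)

/-! ### Graphs of algebras -/

namespace VGraph

variable (T) (A : VGraph.{w} V)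

/-- The graph `T_* A`. -/
abbrev monadGraph : VGraph.{w} V := ⟨A.obj, fun a b => T.obj (A.hom a b)⟩

/-- The morphism of graphs `T_* F`. -/
abbrev monadGraphMap {A B : VGraph.{w} V} (F : A ⟶ B) : monadGraph T A ⟶ monadGraph T B :=
  ⟨F.obj, fun a b => T.map (F.hom a b)⟩

/-- The unit of `T_*`. -/
abbrev monadGraphUnit : A ⟶ monadGraph T A := ⟨fun a => a, fun a b => T.η.app (A.hom a b)⟩

/-- The multiplication of `T_*`. -/
abbrev monadGraphMul : monadGraph T (monadGraph T A) ⟶ monadGraph T A :=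
  ⟨fun a => a, fun a b => T.μ.app (A.hom a b)⟩

/-- The underlying graph of a graph of algebras. -/
abbrev underGraph {T : Monad V} (G : VGraph.{w} T.Algebra) : VGraph.{w} V :=
  ⟨G.obj, fun a b => (G.hom a b).A⟩

variable {T A}

/-- The algebra structures of a graph of algebras. -/
abbrev algebraMap (G : VGraph.{w} T.Algebra) : monadGraph T (underGraph G) ⟶ underGraph G :=
  ⟨fun a => a, fun a b => (G.hom a b).a⟩

/-- The underlying morphism of a morphism of graphs of algebras. -/
abbrev underGraphMap {G G' : VGraph.{w} T.Algebra} (F : G ⟶ G') : underGraph G ⟶ underGraph G' :=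
  ⟨F.obj, fun a b => (F.hom a b).f⟩

theorem hom_mk_inj {A B : VGraph.{w} V} {o : A.obj → B.obj}
    {f g : ∀ a b, A.hom a b ⟶ B.hom (o a) (o b)}
    (h : (⟨o, f⟩ : VGraph.Hom A B) = ⟨o, g⟩) (a b : A.obj) : f a b = g a b := by
  cases h
  rfl

/-- Replaces an object map that is only provably the identity by the literal identity, after which
hom-components can be compared without transport. -/
theorem exists_hom_eq {O : Type w} {h h' : O → O → V}
    (F : (⟨O, h⟩ : VGraph.{w} V) ⟶ ⟨O, h'⟩) (hF : F.obj = fun a => a) :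
    ∃ f : ∀ a b, h a b ⟶ h' a b, F = ⟨fun a => a, f⟩ := by
  obtain ⟨o, f⟩ := F
  obtain rfl : o = fun a => a := hF
  exact ⟨f, rfl⟩

end VGraph

variable [HasFiniteProducts V] (P : Operad T.Algebra)

/-! ### Cells over algebras and their transforms under the monad -/

namespace Operad

/-- The underlying generalised elements, as a morphism of operads. -/
noncomputable def pushHom {X : V} {Z : T.Algebra} (f : X ⟶ Z.A) :
    (P.stage Z).Hom ((P.underlying T).stage X) where
  toFun p := P.push T.forget (Z := Z) f p
  arity_eq _ := rfl
  map_one := P.push_one T.forget (Z := Z) f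
  map_comp := P.push_comp T.forget (Z := Z) f

/-- Generalised elements of the underlying operad extend to free algebras. -/
noncomputable def liftHom (X : V) :
    ((P.underlying T).stage X).Hom (P.stage (T.free.obj X)) :=
  (P.pushHom (Z := T.free.obj X) (T.η.app X)).ofInverse
    (fun q => ⟨q.arity, algebraLift T q.hom⟩)
    (fun p => congrArg (OperadData.El.mk p.arity) (algebraLift_unit p.hom))
    (fun q => congrArg (OperadData.El.mk (P := (P.underlying T).toOperadData) q.arity)
      (unit_algebraLift q.hom))

variable {P} {G : VGraph.{w} T.Algebra} {a b : G.obj}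

/-- The underlying string of generalised elements. -/
noncomputable def Cells.under {Z : T.Algebra} (x : P.Cells G Z a b) :
    (P.underlying T).Cells (VGraph.underGraph G) Z.A a b :=
  x.mapHom (H' := fun a b : G.obj => Z.A ⟶ (G.hom a b).A) (P.pushHom (𝟙 Z.A)) (fun a => a)
    (fun _ _ f => f.f)

/-- The extension to a free algebra of a string of generalised elements. -/
noncomputable def Cells.lift {X : V}
    (x : (P.underlying T).Cells (VGraph.underGraph G) X a b) :
    P.Cells G (T.free.obj X) a b :=
  SetOperad.Free.mapHom (H := fun a b : G.obj => X ⟶ (G.hom a b).A)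
    (H' := fun a b : G.obj => T.free.obj X ⟶ G.hom a b) (P.liftHom X) (fun a => a)
    (fun _ _ f => algebraLift T f) x

/-- Apply the monad to a string of generalised elements, using the algebra structures of the
operad. -/
noncomputable def Cells.monadMap {A : VGraph.{w} V} {a b : A.obj} {X : V}
    (x : (P.underlying T).Cells A X a b) :
    (P.underlying T).Cells (VGraph.monadGraph T A) (T.obj X) a b :=
  SetOperad.Free.mapHom (H' := fun a b : A.obj => T.obj X ⟶ T.obj (A.hom a b))
    ((P.liftHom X).comp (P.pushHom (Z := T.free.obj X) (𝟙 (T.obj X)))) (fun a => a)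
    (fun _ _ f => T.map f) x

/-- This is where the algebra structure of `P` enters the law: operations are brought back from `T
P(k)` to `P(k)`, while arrows merely have `T` applied. -/
theorem monadMap_op (X : V) (p : (P.underlying T).El X) :
    ((P.liftHom X).comp (P.pushHom (Z := T.free.obj X) (𝟙 (T.obj X)))).toFun p =
      ⟨p.arity, T.map p.hom ≫ (P.obj p.arity).a⟩ :=
  congrArg (OperadData.El.mk (P := (P.underlying T).toOperadData) p.arity) (Category.id_comp _)

theorem Cells.monadMap_restrict {A : VGraph.{w} V} {a b : A.obj} {X Y : V} (u : X ⟶ Y)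
    (x : (P.underlying T).Cells A Y a b) :
    (x.restrict u).monadMap = x.monadMap.restrict (T.map u) := by
  -- Each side is fused into a single `mapHom`; the two uses of `symm` only serve to reach the right
  -- side.
  refine (SetOperad.Free.mapHom_mapHom _ _ _ _ _ _ x).trans ?_
  symm
  refine (SetOperad.Free.mapHom_mapHom _ _ _ _ _ _ x).trans ?_
  symm
  refine SetOperad.Free.mapHom_congr ?_ ?_ x
  · intro p
    refine (monadMap_op X _).trans ?_
    refine Eq.trans ?_ (congrArg ((P.underlying T).elMap (T.map u)) (monadMap_op Y p)).symm
    refine congrArg (OperadData.El.mk (P := (P.underlying T).toOperadData) p.arity) ?_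
    exact (congrArg (· ≫ (P.obj p.arity).a) (T.map_comp u p.hom)).trans (Category.assoc _ _ _)
  · intro a b f
    exact T.map_comp u f

theorem Cells.monadMap_mapGraph {A B : VGraph.{w} V} (F : A ⟶ B) {a b : A.obj} {X : V}
    (x : (P.underlying T).Cells A X a b) :
    (x.mapGraph F).monadMap = x.monadMap.mapGraph (VGraph.monadGraphMap T F) := by
  refine (SetOperad.Free.mapHom_mapHom _ _ _ _ _ _ x).trans ?_
  symm
  refine (SetOperad.Free.mapHom_mapHom _ _ _ _ _ _ x).trans ?_
  symm
  refine SetOperad.Free.mapHom_congr (fun p => rfl) ?_ x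
  intro a b f
  exact T.map_comp f (F.hom a b)

/-- The unit axiom of the algebra `P(k)` handles operations and naturality of `η` handles arrows. It
becomes the law's axiom for the unit of `T_*`. -/
theorem Cells.restrict_unit_monadMap {A : VGraph.{w} V} {a b : A.obj} {X : V}
    (x : (P.underlying T).Cells A X a b) :
    x.monadMap.restrict (T.η.app X) = x.mapGraph (VGraph.monadGraphUnit T A) := by
  refine (SetOperad.Free.mapHom_mapHom _ _ _ _ _ _ x).trans ?_
  refine SetOperad.Free.mapHom_congr ?_ ?_ x
  · intro p
    refine (congrArg ((P.underlying T).elMap (T.η.app X)) (monadMap_op X p)).trans ?_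
    exact congrArg (OperadData.El.mk (P := (P.underlying T).toOperadData) p.arity)
      (unit_algebraLift p.hom)
  · intro a b f
    exact (T.η.naturality f).symm

/-- The associativity axiom of the algebra `P(k)` handles operations and naturality of `μ` handles
arrows. It becomes the law's axiom for the multiplication of `T_*`. -/
theorem Cells.restrict_mul_monadMap {A : VGraph.{w} V} {a b : A.obj} {X : V}
    (x : (P.underlying T).Cells A X a b) :
    x.monadMap.restrict (T.μ.app X) =
      x.monadMap.monadMap.mapGraph (VGraph.monadGraphMul T A) := by
  refine (SetOperad.Free.mapHom_mapHom _ _ _ _ _ _ x).trans ?_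
  symm
  refine (congrArg (Cells.mapGraph _) (SetOperad.Free.mapHom_mapHom _ _ _ _ _ _ x)).trans ?_
  refine (SetOperad.Free.mapHom_mapHom _ _ _ _ _ _ x).trans ?_
  symm
  refine SetOperad.Free.mapHom_congr ?_ ?_ x
  · intro p
    refine (congrArg ((P.underlying T).elMap (T.μ.app X)) (monadMap_op X p)).trans ?_
    refine Eq.trans ?_ ((congrArg _ (monadMap_op X p)).trans (monadMap_op (T.obj X) _)).symm
    refine congrArg (OperadData.El.mk (P := (P.underlying T).toOperadData) p.arity) ?_
    exact (algebraLift T p.hom).h.symm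
  · intro a b f
    exact (T.μ.naturality f).symm

theorem monadMap_pure {A : VGraph.{w} V} {a b : A.obj} {X : V} (f : X ⟶ A.hom a b) :
    Cells.monadMap (P := P) (A := A) (SetOperad.Free.pure ((P.underlying T).stage X) f) =
      SetOperad.Free.pure (H := fun a b : A.obj => T.obj X ⟶ T.obj (A.hom a b))
        ((P.underlying T).stage (T.obj X)) (T.map f) :=
  SetOperad.Free.mapHom_pure (H := fun a b : A.obj => X ⟶ A.hom a b)
    (H' := fun a b : A.obj => T.obj X ⟶ T.obj (A.hom a b)) _ (fun a => a) (fun _ _ f => T.map f) f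

/-- Apply the monad to a string of strings of generalised elements. -/
noncomputable def monadMapCells {A : VGraph.{w} V} {a b : A.obj} {X : V}
    (x : ((P.underlying T).stage X).Free (fun a b => (P.underlying T).Cells A X a b) a b) :
    ((P.underlying T).stage (T.obj X)).Free
      (fun a b : A.obj => (P.underlying T).Cells (VGraph.monadGraph T A) (T.obj X) a b) a b :=
  x.mapHom ((P.liftHom X).comp (P.pushHom (Z := T.free.obj X) (𝟙 (T.obj X)))) (fun a => a)
    (fun _ _ y => y.monadMap)

/-- The map on operations passes through generalised elements of `P` at a free algebra and is a
morphism of operads, because composition in `P` takes place among homomorphisms of algebras. -/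
theorem monadMap_join {A : VGraph.{w} V} {a b : A.obj} {X : V}
    (x : ((P.underlying T).stage X).Free (fun a b => (P.underlying T).Cells A X a b) a b) :
    Cells.monadMap (P := P) (A := A) x.join = (monadMapCells x).join :=
  SetOperad.Free.mapHom_join _ _ _ x

end Operad

end FreeAlgebras

/-! ### The distributive law -/

section Law

variable {C : Type w} [SmallCategory C] {T : Monad (Cᵒᵖ ⥤ Type w)}
  [hT : ∀ J : Type w, PreservesColimitsOfShape (Discrete J) T.toFunctor] (P : Operad T.Algebra)

namespace Operad

variable (A : VGraph.{w} (Cᵒᵖ ⥤ Type w)) (a b : A.obj)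

/-- Preservation of coproducts by `T` allows the law to be prescribed on cells, where it is
`Cells.monadMap`; only naturality in the stage has to be checked. -/
theorem exists_lawHom :
    ∃ m : T.obj ((P.underlying T).fcHom A a b) ⟶
        (P.underlying T).fcHom (VGraph.monadGraph T A) a b,
      ∀ {X : Cᵒᵖ ⥤ Type w} (x : (P.underlying T).Cells A X a b),
        T.map x.emb ≫ m = x.monadMap.emb :=
  exists_map_fcHom_desc T.toFunctor (fun x => x.monadMap.emb) (fun u x => by
    rw [Cells.monadMap_restrict, Cells.emb_restrict])

/-- The components of the distributive law. -/
noncomputable def lawHom : T.obj ((P.underlying T).fcHom A a b) ⟶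
    (P.underlying T).fcHom (VGraph.monadGraph T A) a b :=
  (P.exists_lawHom A a b).choose

variable {A a b}

theorem map_emb_lawHom {X : Cᵒᵖ ⥤ Type w} (x : (P.underlying T).Cells A X a b) :
    T.map x.emb ≫ P.lawHom A a b = x.monadMap.emb :=
  (P.exists_lawHom A a b).choose_spec x

theorem lawHom_naturality {B : VGraph.{w} (Cᵒᵖ ⥤ Type w)} (F : A ⟶ B) :
    T.map ((P.underlying T).fcMap F a b) ≫ P.lawHom B (F.obj a) (F.obj b) =
      P.lawHom A a b ≫ (P.underlying T).fcMap (VGraph.monadGraphMap T F) a b := by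
  refine map_fcHom_hom_ext T.toFunctor fun X x => ?_
  rw [← T.map_comp_assoc, ← Cells.emb_mapGraph, map_emb_lawHom, ← Category.assoc,
    map_emb_lawHom, Cells.monadMap_mapGraph, Cells.emb_mapGraph]

theorem unit_lawHom : T.η.app ((P.underlying T).fcHom A a b) ≫ P.lawHom A a b =
    (P.underlying T).fcMap (VGraph.monadGraphUnit T A) a b := by
  refine map_fcHom_hom_ext (𝟭 _) fun X x => ?_
  have h := T.η.naturality x.emb
  dsimp at h ⊢
  rw [reassoc_of% h, map_emb_lawHom, ← Cells.emb_mapGraph, ← Cells.emb_restrict,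
    Cells.restrict_unit_monadMap]

/-- No decomposition is needed: the inclusion of generators is itself the embedding of a cell, the
single arrow `𝟙` with the identity operation. -/
theorem map_fcUnit_lawHom : T.map ((P.underlying T).fcUnit A a b) ≫ P.lawHom A a b =
    (P.underlying T).fcUnit (VGraph.monadGraph T A) a b := by
  have h := emb_pure (P := P.underlying T) (A := A) (𝟙 (A.hom a b))
  rw [Category.id_comp] at h
  rw [← h, map_emb_lawHom, monadMap_pure, T.map_id]
  exact (emb_pure (P := P.underlying T) (A := (VGraph.mapMonad T).obj A)
    (𝟙 (T.obj (A.hom a b)))).trans (Category.id_comp _)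

theorem mul_lawHom : T.μ.app ((P.underlying T).fcHom A a b) ≫ P.lawHom A a b =
    T.map (P.lawHom A a b) ≫ P.lawHom (VGraph.monadGraph T A) a b ≫
      (P.underlying T).fcMap (VGraph.monadGraphMul T A) a b := by
  refine map_fcHom_hom_ext (T.toFunctor ⋙ T.toFunctor) fun X x => ?_
  have h := T.μ.naturality x.emb
  dsimp at h ⊢
  rw [reassoc_of% h, map_emb_lawHom, ← Cells.emb_restrict, Cells.restrict_mul_monadMap,
    Cells.emb_mapGraph, ← T.map_comp_assoc, map_emb_lawHom, ← Category.assoc, map_emb_lawHom]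

variable (A) in
/-- The distributive law, at a graph. -/
noncomputable abbrev lawGraph : VGraph.monadGraph T ((P.underlying T).fcGraph A) ⟶
    (P.underlying T).fcGraph (VGraph.monadGraph T A) :=
  ⟨fun a => a, fun a b => P.lawHom A a b⟩

theorem map_fcMul_lawHom : T.map ((P.underlying T).fcMul A a b) ≫ P.lawHom A a b =
    P.lawHom ((P.underlying T).fcGraph A) a b ≫ (P.underlying T).fcMap (P.lawGraph A) a b ≫
      (P.underlying T).fcMul (VGraph.monadGraph T A) a b := by
  refine map_fcHom_fcHom_hom_ext T.toFunctor fun X x => ?_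
  -- Applying `T` to the outer cell and then the law to each of its arrows is the same as applying
  -- `monadMap` at both levels.
  have e : (embCells x).monadMap.mapGraph (P.lawGraph A) = embCells (monadMapCells x) := by
    refine (congrArg (Cells.mapGraph _) (SetOperad.Free.mapHom_mapHom _ _ _ _ _ _ x)).trans ?_
    refine (SetOperad.Free.mapHom_mapHom _ _ _ _ _ _ x).trans ?_
    symm
    refine (SetOperad.Free.mapHom_mapHom _ _ _ _ _ _ x).trans ?_
    symm
    refine SetOperad.Free.mapHom_congr (fun p => rfl) ?_ x
    intro a b y
    exact P.map_emb_lawHom y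
  rw [← T.map_comp_assoc, ← emb_join, map_emb_lawHom, monadMap_join, emb_join, ← e,
    Cells.emb_mapGraph, Category.assoc]
  exact (congrArg (· ≫ _) (P.map_emb_lawHom (embCells x)).symm).trans (Category.assoc _ _ _)

/-- The distributive law between the monads `T_*` and `fc`. -/
noncomputable def law : DistributiveLaw (VGraph.mapMonad.{w} T) (P.underlying T).fc where
  law :=
    { app := fun A => P.lawGraph A
      naturality := by
        intro A B F
        refine VGraph.Hom.ext rfl (heq_of_eq ?_)
        funext a b
        exact P.lawHom_naturality F }
  unit_left A := by
    refine VGraph.Hom.ext rfl (heq_of_eq ?_)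
    funext a b
    exact P.unit_lawHom
  unit_right A := by
    refine VGraph.Hom.ext rfl (heq_of_eq ?_)
    funext a b
    exact P.map_fcUnit_lawHom
  mul_left A := by
    refine VGraph.Hom.ext rfl (heq_of_eq ?_)
    funext a b
    exact P.mul_lawHom
  mul_right A := by
    refine VGraph.Hom.ext rfl (heq_of_eq ?_)
    funext a b
    exact P.map_fcMul_lawHom

end Operad

end Law

/-! ### Underlying and extended strings of generalised elements -/

section Underlying

variable {V : Type u} [Category.{v} V] [HasFiniteProducts V] {T : Monad V} {P : Operad T.Algebra}
  {G : VGraph.{w} T.Algebra} {a b : G.obj} {X : V} {Z : T.Algebra}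

namespace Operad

theorem underlying_el_congr {X : V} {k : ℕ} {f g : X ⟶ (P.obj k).A} (h : f = g) :
    (⟨k, f⟩ : (P.underlying T).El X) = ⟨k, g⟩ := by
  rw [h]

theorem pushHom_id (p : P.El Z) :
    (P.pushHom (𝟙 Z.A)).toFun p = (⟨p.arity, p.hom.f⟩ : (P.underlying T).El Z.A) :=
  underlying_el_congr (Category.id_comp _)

namespace Cells

theorem under_restrict {Z' : T.Algebra} (u : Z ⟶ Z') (x : P.Cells G Z' a b) :
    (x.restrict u).under = x.under.restrict u.f := by
  refine (SetOperad.Free.mapHom_mapHom _ _ _ _ _ _ x).trans ?_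
  symm
  refine (SetOperad.Free.mapHom_mapHom _ _ _ _ _ _ x).trans ?_
  symm
  refine SetOperad.Free.mapHom_congr ?_ (fun _ _ _ => rfl) x
  intro p
  refine (pushHom_id _).trans ?_
  exact (congrArg ((P.underlying T).elMap u.f) (pushHom_id p)).symm

theorem under_mapGraph {G' : VGraph.{w} T.Algebra} (F : G ⟶ G') (x : P.Cells G Z a b) :
    (x.mapGraph F).under = x.under.mapGraph (VGraph.underGraphMap F) := by
  refine (SetOperad.Free.mapHom_mapHom _ _ _ _ _ _ x).trans ?_
  symm
  refine (SetOperad.Free.mapHom_mapHom _ _ _ _ _ _ x).trans ?_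
  symm
  exact SetOperad.Free.mapHom_congr (fun _ => rfl) (fun _ _ _ => rfl) x

/-- At an algebra stage all entries of a cell are homomorphisms, so each commutes with the structure
maps. This makes the composite of a cell a homomorphism in `FcAlgebra.actCells`. -/
theorem under_restrict_a (x : P.Cells G Z a b) :
    x.under.restrict Z.a = x.under.monadMap.mapGraph (VGraph.algebraMap G) := by
  refine (SetOperad.Free.mapHom_mapHom _ _ _ _ _ _ x).trans ?_
  symm
  refine (congrArg (Cells.mapGraph _) (SetOperad.Free.mapHom_mapHom _ _ _ _ _ _ x)).trans ?_
  refine (SetOperad.Free.mapHom_mapHom _ _ _ _ _ _ x).trans ?_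
  symm
  refine SetOperad.Free.mapHom_congr ?_ ?_ x
  · intro p
    refine (congrArg ((P.underlying T).elMap Z.a) (pushHom_id p)).trans ?_
    refine Eq.trans ?_ ((congrArg _ (pushHom_id p)).trans (monadMap_op Z.A _)).symm
    exact underlying_el_congr p.hom.h.symm
  · intro a b f
    exact f.h.symm

theorem lift_restrict {Y : V} (u : X ⟶ Y)
    (x : (P.underlying T).Cells (VGraph.underGraph G) Y a b) :
    (x.restrict u).lift = x.lift.restrict (T.free.map u) := by
  have key : ∀ {Z : T.Algebra} (f : Y ⟶ Z.A),
      algebraLift T (u ≫ f) = T.free.map u ≫ algebraLift T f := by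
    intro Z f
    apply Monad.Algebra.Hom.ext
    exact (congrArg (· ≫ Z.a) (T.map_comp u f)).trans (Category.assoc _ _ _)
  refine (SetOperad.Free.mapHom_mapHom _ _ _ _ _ _ x).trans ?_
  symm
  refine (SetOperad.Free.mapHom_mapHom _ _ _ _ _ _ x).trans ?_
  symm
  refine SetOperad.Free.mapHom_congr ?_ ?_ x
  rotate_left
  · intro _ _ f
    exact key f
  intro p
  exact congrArg (OperadData.El.mk p.arity) (key p.hom)

theorem lift_mapGraph {G' : VGraph.{w} T.Algebra} (F : G ⟶ G')
    (x : (P.underlying T).Cells (VGraph.underGraph G) X a b) :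
    Cells.lift (G := G') (x.mapGraph (VGraph.underGraphMap F)) = x.lift.mapGraph F := by
  refine (SetOperad.Free.mapHom_mapHom _ _ _ _ _ _ x).trans ?_
  symm
  refine (SetOperad.Free.mapHom_mapHom _ _ _ _ _ _ x).trans ?_
  symm
  refine SetOperad.Free.mapHom_congr (fun _ => rfl) ?_ x
  intro a b f
  apply Monad.Algebra.Hom.ext
  change T.map (f ≫ (F.hom a b).f) ≫ _ = (T.map f ≫ _) ≫ (F.hom a b).f
  rw [T.map_comp, Category.assoc, Category.assoc, (F.hom a b).h]

/-- `algebraLift T (𝟙 Z.A)` is the counit of the free-forgetful adjunction; extending an underlying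
homomorphism to the free algebra is precomposition with it. -/
theorem lift_under (x : P.Cells G Z a b) :
    x.under.lift = x.restrict (algebraLift T (𝟙 Z.A)) := by
  have key : ∀ {W : T.Algebra} (f : Z ⟶ W),
      algebraLift T f.f = algebraLift T (𝟙 Z.A) ≫ f := by
    intro W f
    apply Monad.Algebra.Hom.ext
    change T.map f.f ≫ W.a = (T.map (𝟙 Z.A) ≫ Z.a) ≫ f.f
    rw [T.map_id, Category.id_comp, f.h]
  refine (SetOperad.Free.mapHom_mapHom _ _ _ _ _ _ x).trans ?_
  refine SetOperad.Free.mapHom_congr ?_ ?_ x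
  rotate_left
  · intro _ _ f
    exact key f
  intro p
  refine (congrArg (P.liftHom Z.A).toFun (pushHom_id p)).trans ?_
  exact congrArg (OperadData.El.mk p.arity) (key p.hom)

/-- `monadMap` already uses the algebra structure on operations, so only the arrows still need
theirs. -/
theorem under_lift (x : (P.underlying T).Cells (VGraph.underGraph G) X a b) :
    x.lift.under = x.monadMap.mapGraph (VGraph.algebraMap G) := by
  refine (SetOperad.Free.mapHom_mapHom _ _ _ _ _ _ x).trans ?_
  symm
  refine (SetOperad.Free.mapHom_mapHom _ _ _ _ _ _ x).trans ?_
  symm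
  exact SetOperad.Free.mapHom_congr (fun _ => rfl) (fun _ _ _ => rfl) x

theorem restrict_unit_under_lift (x : (P.underlying T).Cells (VGraph.underGraph G) X a b) :
    x.lift.under.restrict (T.η.app X) = x := by
  refine (congrArg (Cells.restrict _) (SetOperad.Free.mapHom_mapHom _ _ _ _ _ _ x)).trans ?_
  refine (SetOperad.Free.mapHom_mapHom _ _ _ _ _ _ x).trans ?_
  refine SetOperad.Free.mapHom_eq_self ?_ ?_ x
  · intro p
    refine (congrArg ((P.underlying T).elMap (T.η.app X)) (monadMap_op X p)).trans ?_
    exact underlying_el_congr (unit_algebraLift p.hom)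
  · intro a b f
    exact unit_algebraLift f

end Cells

theorem under_pure (f : Z ⟶ G.hom a b) :
    Cells.under (SetOperad.Free.pure (H := fun a b : G.obj => Z ⟶ G.hom a b) (P.stage Z) f) =
      SetOperad.Free.pure (H := fun a b : G.obj => Z.A ⟶ (G.hom a b).A)
        ((P.underlying T).stage Z.A) f.f :=
  SetOperad.Free.mapHom_pure (H := fun a b : G.obj => Z ⟶ G.hom a b)
    (H' := fun a b : G.obj => Z.A ⟶ (G.hom a b).A) _ (fun a => a) (fun _ _ f => f.f) f

/-- The underlying string of strings of generalised elements. -/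
noncomputable def underCells (x : (P.stage Z).Free (fun a b => P.Cells G Z a b) a b) :
    ((P.underlying T).stage Z.A).Free
      (fun a b => (P.underlying T).Cells (VGraph.underGraph G) Z.A a b) a b :=
  x.mapHom (H' := fun a b : G.obj => (P.underlying T).Cells (VGraph.underGraph G) Z.A a b)
    (P.pushHom (𝟙 Z.A)) (fun a => a) (fun _ _ y => y.under)

theorem under_join (x : (P.stage Z).Free (fun a b => P.Cells G Z a b) a b) :
    Cells.under (P := P) (G := G) x.join = (underCells x).join :=
  SetOperad.Free.mapHom_join _ _ _ x

/-- The extension to a free algebra of a string of strings of generalised elements. -/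
noncomputable def liftCells (x : ((P.underlying T).stage X).Free
      (fun a b => (P.underlying T).Cells (VGraph.underGraph G) X a b) a b) :
    (P.stage (T.free.obj X)).Free (fun a b => P.Cells G (T.free.obj X) a b) a b :=
  x.mapHom (H' := fun a b : G.obj => P.Cells G (T.free.obj X) a b)
    (P.liftHom X) (fun a => a) (fun _ _ y => y.lift)

theorem lift_join (x : ((P.underlying T).stage X).Free
      (fun a b => (P.underlying T).Cells (VGraph.underGraph G) X a b) a b) :
    Cells.lift (P := P) (G := G) x.join = (liftCells x).join :=
  SetOperad.Free.mapHom_join _ _ _ x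

end Operad

end Underlying

/-! ### Morphisms of algebras of the composite monad -/

section Composite

variable {E : Type u} [Category.{v} E] {S T : Monad E} (d : DistributiveLaw S T)

/-- A morphism commuting with both actions is a morphism of algebras of the composite monad. -/
def DistributiveLaw.algebraHomMk {X Y : d.composite.Algebra} (f : X.A ⟶ Y.A)
    (hS : S.map f ≫ d.actLeft Y = d.actLeft X ≫ f)
    (hT : T.map f ≫ d.actRight Y = d.actRight X ≫ f) : X ⟶ Y where
  f := f
  h := by
    change T.map (S.map f) ≫ d.structureMap Y = d.structureMap X ≫ f
    have hX : d.structureMap X = T.map (d.actLeft X) ≫ d.actRight X :=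
      (d.map_actLeft_actRight X).symm
    have hY : d.structureMap Y = T.map (d.actLeft Y) ≫ d.actRight Y :=
      (d.map_actLeft_actRight Y).symm
    rw [hX, hY, ← T.map_comp_assoc, hS, T.map_comp_assoc, hT, Category.assoc]

theorem algebra_mk_eq {X : S.Algebra} {a : S.obj X.A ⟶ X.A} (h : S.η.app X.A ≫ a = 𝟙 X.A)
    (h' : S.μ.app X.A ≫ a = S.map a ≫ a) (e : a = X.a) : (⟨X.A, a, h, h'⟩ : S.Algebra) = X := by
  subst e
  rfl

/-- Functors into the source of a faithful functor agree if they agree on objects and after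
composition with that functor. -/
theorem functor_eq_of_faithful {𝒜 ℬ 𝒞 : Type*} [Category 𝒜] [Category ℬ] [Category 𝒞]
    {F F' : 𝒜 ⥤ ℬ} (U : ℬ ⥤ 𝒞) [U.Faithful] (h : ∀ X, F.obj X = F'.obj X)
    (hU : F ⋙ U = F' ⋙ U) : F = F' := by
  refine CategoryTheory.Functor.ext h fun X Y f => U.map_injective ?_
  -- The correcting `eqToHom` morphisms are sent by `U` to `eqToHom` morphisms.
  have e := Functor.congr_hom hU f
  simpa [eqToHom_map] using e

end Composite

/-! ### Algebras of the composite monad as weakened categories of algebras -/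

section Comparison

variable {C : Type w} [SmallCategory C] {T : Monad (Cᵒᵖ ⥤ Type w)} (P : Operad T.Algebra)

namespace PCategory

variable {P}

/-- Composition in `D` is available only at algebra stages. A cell at a presheaf stage is extended
to the free algebra, composed there, and restricted along the unit; naturality of `η` makes this
natural in the stage. -/
theorem exists_fcAct (D : PCategory.{w} P) (a b : D.obj) :
    ∃ m : (P.underlying T).fcHom (VGraph.underGraph D.toVGraph) a b ⟶ (D.hom a b).A,
      ∀ {X : Cᵒᵖ ⥤ Type w} (x : (P.underlying T).Cells (VGraph.underGraph D.toVGraph) X a b),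
        x.emb ≫ m = T.η.app X ≫ (D.act x.lift).f :=
  Operad.exists_map_fcHom_desc (𝟭 _) (fun {X} x => T.η.app X ≫ (D.act x.lift).f)
    (by
      intro X X' u x
      have h := T.η.naturality u
      rw [Operad.Cells.lift_restrict, D.act_restrict]
      exact (Category.assoc _ _ _).symm.trans
        ((congrArg (· ≫ (D.act x.lift).f) h.symm).trans (Category.assoc _ _ _)))

/-- The action of `fc` on the underlying graph of a weakened category of algebras. -/
noncomputable def fcAct (D : PCategory.{w} P) (a b : D.obj) :
    (P.underlying T).fcHom (VGraph.underGraph D.toVGraph) a b ⟶ (D.hom a b).A :=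
  (exists_fcAct D a b).choose

theorem emb_fcAct (D : PCategory.{w} P) {a b : D.obj} {X : Cᵒᵖ ⥤ Type w}
    (x : (P.underlying T).Cells (VGraph.underGraph D.toVGraph) X a b) :
    x.emb ≫ fcAct D a b = T.η.app X ≫ (D.act x.lift).f :=
  (exists_fcAct D a b).choose_spec x

/-- At an algebra stage the detour through the free algebra is undone by the triangle identity,
which recovers the composition of `D`. -/
theorem emb_under_fcAct (D : PCategory.{w} P) {a b : D.obj} {Z : T.Algebra}
    (x : P.Cells D.toVGraph Z a b) :
    x.under.emb ≫ fcAct D a b = (D.act x).f := by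
  rw [emb_fcAct, Operad.Cells.lift_under, D.act_restrict]
  exact (Category.assoc _ _ _).symm.trans ((congrArg (· ≫ (D.act x).f)
    (unit_algebraLift (𝟙 Z.A))).trans (Category.id_comp _))

end PCategory

variable [hT : ∀ J : Type w, PreservesColimitsOfShape (Discrete J) T.toFunctor]

/-- Compatible actions of `T_*` and `fc` on a graph, the identity on objects. -/
@[ext]
structure FcAlgebra (A : VGraph.{w} (Cᵒᵖ ⥤ Type w)) where
  alg : ∀ a b, T.obj (A.hom a b) ⟶ A.hom a b
  act : ∀ a b, (P.underlying T).fcHom A a b ⟶ A.hom a b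
  alg_unit : ∀ a b, T.η.app (A.hom a b) ≫ alg a b = 𝟙 _
  alg_assoc : ∀ a b, T.μ.app (A.hom a b) ≫ alg a b = T.map (alg a b) ≫ alg a b
  act_unit : ∀ a b, (P.underlying T).fcUnit A a b ≫ act a b = 𝟙 _
  act_assoc : ∀ a b, (P.underlying T).fcMul A a b ≫ act a b =
    (P.underlying T).fcMap (A := (P.underlying T).fcGraph A) (B := A) ⟨fun a => a, act⟩ a b ≫ act a b
  compat : ∀ a b, T.map (act a b) ≫ alg a b = P.lawHom A a b ≫
    (P.underlying T).fcMap (A := VGraph.monadGraph T A) (B := A) ⟨fun a => a, alg⟩ a b ≫ act a b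

namespace FcAlgebra

variable {P} {A B : VGraph.{w} (Cᵒᵖ ⥤ Type w)}

/-- The action of `T_*`, as a morphism of graphs. -/
abbrev algGraph (M : FcAlgebra P A) : VGraph.monadGraph T A ⟶ A := ⟨fun a => a, M.alg⟩

/-- The action of `fc`, as a morphism of graphs. -/
abbrev actGraph (M : FcAlgebra P A) : (P.underlying T).fcGraph A ⟶ A := ⟨fun a => a, M.act⟩

/-! #### Comparison with algebras of the composite monad -/

/-- The algebra of the composite monad given by compatible actions. -/
noncomputable def toAlgebra (M : FcAlgebra P A) : P.law.composite.Algebra :=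
  P.law.algebraMk (A := A) M.algGraph M.actGraph
    (by
      refine VGraph.Hom.ext rfl (heq_of_eq ?_)
      funext a b
      exact M.alg_unit a b)
    (by
      refine VGraph.Hom.ext rfl (heq_of_eq ?_)
      funext a b
      exact M.alg_assoc a b)
    (by
      refine VGraph.Hom.ext rfl (heq_of_eq ?_)
      funext a b
      exact M.act_unit a b)
    (by
      refine VGraph.Hom.ext rfl (heq_of_eq ?_)
      funext a b
      exact M.act_assoc a b)
    (by
      refine VGraph.Hom.ext rfl (heq_of_eq ?_)
      funext a b
      exact M.compat a b)

theorem actLeft_toAlgebra (M : FcAlgebra P A) : P.law.actLeft M.toAlgebra = M.algGraph :=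
  P.law.actLeft_algebraMk _ _ _ _ _

theorem actRight_toAlgebra (M : FcAlgebra P A) : P.law.actRight M.toAlgebra = M.actGraph :=
  P.law.actRight_algebraMk _ _ _ _ _

/-- The unit of `T_*` is the identity on objects, so the unit axiom forces the action to be the
identity on objects as well. The same argument gives `exists_act`. -/
theorem exists_alg (X : P.law.composite.Algebra) :
    ∃ α : ∀ a b, T.obj (X.A.hom a b) ⟶ X.A.hom a b,
      P.law.actLeft X = (⟨fun a => a, α⟩ : VGraph.monadGraph T X.A ⟶ X.A) :=
  VGraph.exists_hom_eq (P.law.actLeft X) (congrArg VGraph.Hom.obj (P.law.unit_actLeft X))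

theorem exists_act (X : P.law.composite.Algebra) :
    ∃ β : ∀ a b, (P.underlying T).fcHom X.A a b ⟶ X.A.hom a b,
      P.law.actRight X = (⟨fun a => a, β⟩ : (P.underlying T).fcGraph X.A ⟶ X.A) :=
  VGraph.exists_hom_eq (P.law.actRight X) (congrArg VGraph.Hom.obj (P.law.unit_actRight X))

/-- The compatible actions given by an algebra of the composite monad. -/
noncomputable def ofAlgebra (X : P.law.composite.Algebra) : FcAlgebra P X.A where
  alg := (exists_alg X).choose
  act := (exists_act X).choose
  alg_unit := by
    have h := P.law.unit_actLeft X
    rw [(exists_alg X).choose_spec] at h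
    exact VGraph.hom_mk_inj h
  alg_assoc := by
    have h := P.law.assoc_actLeft X
    rw [(exists_alg X).choose_spec] at h
    exact VGraph.hom_mk_inj h
  act_unit := by
    have h := P.law.unit_actRight X
    rw [(exists_act X).choose_spec] at h
    exact VGraph.hom_mk_inj h
  act_assoc := by
    have h := P.law.assoc_actRight X
    rw [(exists_act X).choose_spec] at h
    exact VGraph.hom_mk_inj h
  compat := by
    have h := P.law.map_actRight_actLeft X
    rw [(exists_alg X).choose_spec, (exists_act X).choose_spec] at h
    exact VGraph.hom_mk_inj h

theorem algGraph_ofAlgebra (X : P.law.composite.Algebra) :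
    (ofAlgebra X).algGraph = P.law.actLeft X := (exists_alg X).choose_spec.symm

theorem actGraph_ofAlgebra (X : P.law.composite.Algebra) :
    (ofAlgebra X).actGraph = P.law.actRight X := (exists_act X).choose_spec.symm

theorem toAlgebra_ofAlgebra (X : P.law.composite.Algebra) : (ofAlgebra X).toAlgebra = X := by
  refine algebra_mk_eq _ _ (Eq.trans ?_ (P.law.map_actLeft_actRight X))
  rw [← algGraph_ofAlgebra, ← actGraph_ofAlgebra]
  rfl

theorem ofAlgebra_toAlgebra (M : FcAlgebra P A) : ofAlgebra M.toAlgebra = M := by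
  refine FcAlgebra.ext ?_ ?_
  · funext a b
    exact VGraph.hom_mk_inj ((algGraph_ofAlgebra M.toAlgebra).trans M.actLeft_toAlgebra) a b
  · funext a b
    exact VGraph.hom_mk_inj ((actGraph_ofAlgebra M.toAlgebra).trans M.actRight_toAlgebra) a b

/-- A morphism of graphs commuting with both actions. -/
structure IsHom (M : FcAlgebra P A) (N : FcAlgebra P B) (F : A ⟶ B) : Prop where
  alg : ∀ a b, T.map (F.hom a b) ≫ N.alg _ _ = M.alg a b ≫ F.hom a b
  act : ∀ a b, (P.underlying T).fcMap F a b ≫ N.act _ _ = M.act a b ≫ F.hom a b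

theorem isHom_ofAlgebra {X Y : P.law.composite.Algebra} (f : X ⟶ Y) :
    IsHom (ofAlgebra X) (ofAlgebra Y) f.f where
  alg := by
    have h := P.law.hom_actLeft f
    rw [← algGraph_ofAlgebra, ← algGraph_ofAlgebra] at h
    exact VGraph.hom_mk_inj h
  act := by
    have h := P.law.hom_actRight f
    rw [← actGraph_ofAlgebra, ← actGraph_ofAlgebra] at h
    exact VGraph.hom_mk_inj h

/-- Morphisms commuting with both actions are morphisms of algebras. -/
noncomputable def toAlgebraHom {M : FcAlgebra P A} {N : FcAlgebra P B} {F : A ⟶ B}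
    (h : IsHom M N F) : M.toAlgebra ⟶ N.toAlgebra :=
  P.law.algebraHomMk (X := M.toAlgebra) (Y := N.toAlgebra) F
    (by
      rw [actLeft_toAlgebra, actLeft_toAlgebra]
      refine VGraph.Hom.ext rfl (heq_of_eq ?_)
      funext a b
      exact h.alg a b)
    (by
      rw [actRight_toAlgebra, actRight_toAlgebra]
      refine VGraph.Hom.ext rfl (heq_of_eq ?_)
      funext a b
      exact h.act a b)

/-! #### Comparison with weakened categories of algebras -/

/-- The graph of algebras underlying compatible actions. -/
abbrev graph (M : FcAlgebra P A) : VGraph.{w} T.Algebra :=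
  ⟨A.obj, fun a b => ⟨A.hom a b, M.alg a b, M.alg_unit a b, M.alg_assoc a b⟩⟩

/-- The action on strings of generalised elements in the category of algebras. -/
noncomputable def actCells (M : FcAlgebra P A) {Z : T.Algebra} {a b : A.obj}
    (x : P.Cells M.graph Z a b) : Z ⟶ M.graph.hom a b where
  f := x.under.emb ≫ M.act a b
  h := by
    change T.map (x.under.emb ≫ M.act a b) ≫ M.alg a b = Z.a ≫ x.under.emb ≫ M.act a b
    -- Compatibility trades the algebra structure on the composite for the algebra structures on the
    -- entries of the cell, with which the cell commutes by `under_restrict_a`.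
    rw [T.map_comp, Category.assoc, M.compat, ← Category.assoc, ← Category.assoc,
      P.map_emb_lawHom, ← Operad.Cells.emb_mapGraph, ← Category.assoc,
      ← Operad.Cells.emb_restrict]
    exact congrArg (fun y => Operad.Cells.emb y ≫ M.act a b)
      (Operad.Cells.under_restrict_a (G := M.graph) x).symm

theorem actCells_restrict (M : FcAlgebra P A) {Z Z' : T.Algebra} (u : Z ⟶ Z') {a b : A.obj}
    (x : P.Cells M.graph Z' a b) : M.actCells (x.restrict u) = u ≫ M.actCells x := by
  apply Monad.Algebra.Hom.ext
  change (x.restrict u).under.emb ≫ M.act a b = u.f ≫ x.under.emb ≫ M.act a b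
  rw [Operad.Cells.under_restrict, Operad.Cells.emb_restrict, Category.assoc]

theorem actCells_pure (M : FcAlgebra P A) {Z : T.Algebra} {a b : A.obj} (f : Z ⟶ M.graph.hom a b) :
    M.actCells (SetOperad.Free.pure (H := fun a b : A.obj => Z ⟶ M.graph.hom a b)
      (P.stage Z) f) = f := by
  apply Monad.Algebra.Hom.ext
  refine (congrArg (fun y => Operad.Cells.emb y ≫ M.act a b) (Operad.under_pure f)).trans ?_
  refine (congrArg (· ≫ M.act a b) (Operad.emb_pure (A := A) f.f)).trans ?_
  rw [Category.assoc, M.act_unit]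
  exact Category.comp_id _

theorem actCells_join (M : FcAlgebra P A) {Z : T.Algebra} {a b : A.obj}
    (x : (P.stage Z).Free (fun a b => P.Cells M.graph Z a b) a b) :
    M.actCells x.join = M.actCells (x.mapHom (H' := fun a b : A.obj => Z ⟶ M.graph.hom a b)
      (SetOperad.Hom.id _) (fun a => a) (fun _ _ y => M.actCells y)) := by
  apply Monad.Algebra.Hom.ext
  refine (congrArg (fun y => Operad.Cells.emb y ≫ M.act a b) (Operad.under_join x)).trans ?_
  refine (congrArg (· ≫ M.act a b) (Operad.emb_join (A := A) (Operad.underCells x))).trans ?_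
  rw [Category.assoc, M.act_assoc, ← Category.assoc, ← Operad.Cells.emb_mapGraph]
  refine congrArg (fun y => Operad.Cells.emb y ≫ M.act a b) ?_
  refine (congrArg (Operad.Cells.mapGraph _)
    (SetOperad.Free.mapHom_mapHom _ _ _ _ _ _ x)).trans ?_
  refine (SetOperad.Free.mapHom_mapHom _ _ _ _ _ _ x).trans ?_
  symm
  refine (SetOperad.Free.mapHom_mapHom _ _ _ _ _ _ x).trans ?_
  exact SetOperad.Free.mapHom_congr (fun _ => rfl) (fun _ _ _ => rfl) x

/-- Shows that the action of `fc` is recovered from composition in the resulting category, by the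
triangle identity on cells. -/
theorem unit_actCells_lift (M : FcAlgebra P A) {X : Cᵒᵖ ⥤ Type w} {a b : A.obj}
    (x : (P.underlying T).Cells A X a b) :
    T.η.app X ≫ (M.actCells (Operad.Cells.lift (G := M.graph) x)).f = x.emb ≫ M.act a b := by
  change T.η.app X ≫ (Operad.Cells.lift (G := M.graph) x).under.emb ≫ M.act a b = _
  refine (Category.assoc _ _ _).symm.trans ?_
  refine congrArg (· ≫ M.act a b) ?_
  refine (Operad.Cells.emb_restrict (A := A) (T.η.app X)
    (Operad.Cells.lift (G := M.graph) x).under).symm.trans ?_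
  exact congrArg (fun y => Operad.Cells.emb y)
    (Operad.Cells.restrict_unit_under_lift (G := M.graph) x)

/-- A morphism commuting with the actions of `T_*`, as a morphism of graphs of algebras. -/
abbrev IsHom.graphMap {M : FcAlgebra P A} {N : FcAlgebra P B} {F : A ⟶ B} (h : IsHom M N F) :
    M.graph ⟶ N.graph :=
  ⟨F.obj, fun a b => ⟨F.hom a b, h.alg a b⟩⟩

theorem IsHom.actCells_comp {M : FcAlgebra P A} {N : FcAlgebra P B} {F : A ⟶ B}
    (h : IsHom M N F) {Z : T.Algebra} {a b : A.obj} (x : P.Cells M.graph Z a b) :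
    M.actCells x ≫ h.graphMap.hom a b = N.actCells (x.mapGraph h.graphMap) := by
  apply Monad.Algebra.Hom.ext
  change (x.under.emb ≫ M.act a b) ≫ F.hom a b = _
  rw [Category.assoc, ← h.act, ← Category.assoc, ← Operad.Cells.emb_mapGraph]
  exact congrArg (fun y => Operad.Cells.emb y ≫ N.act _ _)
    (Operad.Cells.under_mapGraph (G := M.graph) (G' := N.graph) h.graphMap x).symm

/-- The weakened category of algebras given by compatible actions. -/
noncomputable def toPCategory (M : FcAlgebra P A) : PCategory.{w} P :=
  PCategory.ofAct M.graph M.actCells M.actCells_restrict M.actCells_pure M.actCells_join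

theorem act_toPCategory (M : FcAlgebra P A) {Z : T.Algebra} {a b : A.obj}
    (x : P.Cells M.graph Z a b) : M.toPCategory.act x = M.actCells x :=
  PCategoryData.act_ofAct M.graph M.actCells M.actCells_restrict x

/-- The compatible actions given by a weakened category of algebras. -/
noncomputable def ofPCategory (D : PCategory.{w} P) :
    FcAlgebra P (VGraph.underGraph D.toVGraph) where
  alg a b := (D.hom a b).a
  act := D.fcAct
  alg_unit a b := (D.hom a b).unit
  alg_assoc a b := (D.hom a b).assoc
  act_unit a b := by
    -- The inclusion of generators is tested on the universal arrow `𝟙`, a pure cell on which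
    -- `D.act_pure` applies.
    have h := D.emb_under_fcAct (SetOperad.Free.pure
      (H := fun a' b' : D.obj => D.hom a b ⟶ D.hom a' b') (P.stage (D.hom a b)) (𝟙 (D.hom a b)))
    have h' := (congrArg (Operad.Cells.emb (P := P.underlying T))
      (Operad.under_pure (P := P) (G := D.toVGraph) (𝟙 (D.hom a b)))).trans
      ((Operad.emb_pure (P := P.underlying T) (A := VGraph.underGraph D.toVGraph)
        (𝟙 (D.hom a b).A)).trans
        (Category.id_comp _))
    exact (congrArg (· ≫ D.fcAct a b) h').symm.trans
      (h.trans (congrArg Monad.Algebra.Hom.f (D.act_pure (𝟙 (D.hom a b)))))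
  act_assoc a b := by
    -- On cells of cells both sides become composites in `D` at the free algebra, where
    -- associativity of `D` is available.
    refine Operad.map_fcHom_fcHom_hom_ext (𝟭 _) fun X x => ?_
    dsimp
    rw [← Category.assoc, ← Category.assoc, ← Operad.emb_join, PCategory.emb_fcAct,
      ← Operad.Cells.emb_mapGraph, PCategory.emb_fcAct, Operad.lift_join, D.act_join']
    refine congrArg (fun y : P.Cells D.toVGraph (T.free.obj X) a b => T.η.app X ≫ (D.act y).f) ?_
    refine (SetOperad.Free.mapHom_mapHom _ _ _ _ _ _ x).trans ?_
    symm
    refine (congrArg (fun y => Operad.Cells.lift y)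
      (SetOperad.Free.mapHom_mapHom _ _ _ _ _ _ x)).trans ?_
    refine (SetOperad.Free.mapHom_mapHom _ _ _ _ _ _ x).trans ?_
    refine SetOperad.Free.mapHom_congr (fun _ => rfl) ?_ x
    intro a b y
    -- The inner composite was restricted along the unit; extending it back to the free algebra
    -- returns the original homomorphism.
    refine (congrArg (algebraLift T) (D.emb_fcAct y)).trans ?_
    exact algebraLift_unit _
  compat a b := by
    refine Operad.map_fcHom_hom_ext T.toFunctor fun X x => ?_
    rw [← Category.assoc, ← Category.assoc, ← T.map_comp, P.map_emb_lawHom, ← Category.assoc,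
      ← Operad.Cells.emb_mapGraph, PCategory.emb_fcAct]
    refine Eq.trans ?_ (congrArg (fun y => Operad.Cells.emb y ≫ D.fcAct a b)
      (Operad.Cells.under_lift x))
    refine Eq.trans ?_ (D.emb_under_fcAct x.lift).symm
    -- Compatibility holds because the composite `D.act x.lift` is a homomorphism out of a free
    -- algebra, hence the extension of its restriction along the unit.
    exact congrArg Monad.Algebra.Hom.f (algebraLift_unit (D.act x.lift))

theorem toPCategory_ofPCategory (D : PCategory.{w} P) : (ofPCategory D).toPCategory = D := by
  refine PCategory.ext_data (Eq.trans ?_ (PCategoryData.ofAct_act D.toPCategoryData))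
  refine PCategoryData.ofAct_congr (G := D.toVGraph) fun x => ?_
  apply Monad.Algebra.Hom.ext
  exact D.emb_under_fcAct x

theorem ofPCategory_toPCategory (M : FcAlgebra P A) : ofPCategory M.toPCategory = M := by
  refine FcAlgebra.ext rfl ?_
  funext a b
  refine Operad.map_fcHom_hom_ext (𝟭 _) fun X x => ?_
  refine (M.toPCategory.emb_fcAct x).trans ?_
  refine (congrArg (fun y => T.η.app X ≫ Monad.Algebra.Hom.f y)
    (M.act_toPCategory (Operad.Cells.lift (G := M.graph) x))).trans ?_
  exact M.unit_actCells_lift x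

theorem isHom_ofPCategory {D D' : PCategory.{w} P} (F : D ⟶ D') :
    IsHom (ofPCategory D) (ofPCategory D') (VGraph.underGraphMap F.graph) where
  alg a b := (F.graph.hom a b).h
  act a b := by
    refine Operad.map_fcHom_hom_ext (𝟭 _) fun X x => ?_
    change x.emb ≫ (P.underlying T).fcMap (VGraph.underGraphMap F.graph) a b ≫ D'.fcAct _ _ =
      x.emb ≫ D.fcAct a b ≫ (F.graph.hom a b).f
    rw [← Category.assoc, ← Category.assoc, ← Operad.Cells.emb_mapGraph, D'.emb_fcAct,
      D.emb_fcAct, Operad.Cells.lift_mapGraph, ← PCategory.Hom.comm_act]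
    exact (Category.assoc _ _ _).symm

/-- Morphisms commuting with both actions are morphisms of weakened categories. -/
noncomputable def toPCategoryHom {M : FcAlgebra P A} {N : FcAlgebra P B} {F : A ⟶ B}
    (h : IsHom M N F) : M.toPCategory ⟶ N.toPCategory :=
  PCategory.Hom.ofAct (A := M.toPCategory) (B := N.toPCategory)
    h.graphMap
    (fun x => (congrArg (· ≫ _) (M.act_toPCategory x)).trans
      ((h.actCells_comp x).trans (N.act_toPCategory _).symm))

end FcAlgebra

end Comparison

/-! ### The isomorphism of categories -/

theorem mainTheorem6 {C : Type w} [SmallCategory C] (T : Monad (Cᵒᵖ ⥤ Type w))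
    (hT : ∀ J : Type w, PreservesColimitsOfShape (Discrete J) T.toFunctor)
    (P : Operad T.Algebra) :
    ∃ (d : DistributiveLaw (VGraph.mapMonad.{w} T) (P.underlying T).fc)
      (E : d.composite.Algebra ⥤ PCategory.{w} P)
      (E' : PCategory.{w} P ⥤ d.composite.Algebra),
      E ⋙ E' = 𝟭 d.composite.Algebra ∧ E' ⋙ E = 𝟭 (PCategory.{w} P) ∧
        E ⋙ PCategory.forget P ⋙ VGraph.mapFunctor T.forget = d.composite.forget := by
  let E : P.law.composite.Algebra ⥤ PCategory.{w} P :=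
    { obj := fun X => (FcAlgebra.ofAlgebra X).toPCategory
      map := fun f => FcAlgebra.toPCategoryHom (FcAlgebra.isHom_ofAlgebra f)
      map_id := fun X => PCategory.Hom.ext rfl
      map_comp := fun f g => PCategory.Hom.ext rfl }
  let E' : PCategory.{w} P ⥤ P.law.composite.Algebra :=
    { obj := fun D => (FcAlgebra.ofPCategory D).toAlgebra
      map := fun F => FcAlgebra.toAlgebraHom (FcAlgebra.isHom_ofPCategory F)
      map_id := fun D => Monad.Algebra.Hom.ext rfl
      map_comp := fun F G => Monad.Algebra.Hom.ext rfl }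
  -- A morphism of weakened categories of algebras carries no data beyond its underlying graph
  -- morphism; being a homomorphism and preserving composition are properties.
  have : (PCategory.forget P ⋙ VGraph.mapFunctor T.forget).Faithful := by
    constructor
    rintro D D' ⟨⟨o, f⟩, _⟩ ⟨⟨o', f'⟩, _⟩ h
    have ho : o = o' := congrArg VGraph.Hom.obj h
    subst ho
    exact PCategory.Hom.ext (VGraph.Hom.ext rfl (heq_of_eq (funext₂ fun a b =>
      Monad.Algebra.Hom.ext (VGraph.hom_mk_inj h a b))))
  refine ⟨P.law, E, E', ?_, ?_, rfl⟩
  -- Neither functor alters the underlying graph or graph morphism, so both round trips commute with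
  -- the forgetful functor by `rfl`, and only equality on objects remains, through `FcAlgebra`.
  · refine functor_eq_of_faithful P.law.composite.forget (fun X => ?_) rfl
    exact (congrArg FcAlgebra.toAlgebra (FcAlgebra.ofPCategory_toPCategory _)).trans
      (FcAlgebra.toAlgebra_ofAlgebra X)
  · refine functor_eq_of_faithful (PCategory.forget P ⋙ VGraph.mapFunctor T.forget)
      (fun D => ?_) rfl
    exact (congrArg FcAlgebra.toPCategory (FcAlgebra.ofAlgebra_toAlgebra _)).trans
      (FcAlgebra.toPCategory_ofPCategory D)
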